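/- Let $\mathbb T$ be the unit circle, parametrised by arc length $\theta\in\mathbb R/2\pi\mathbb Z$, and let $\Omega=\mathbb T\times(0,1)$, with points $z=(\theta,r)$, $\Gamma=\mathbb T\times\{1\}$, $\Gamma^*=\mathbb T\times\{0\}$. Let $\alpha\in[1,2)$, $w=r^\alpha$ and $A=\operatorname{diag}(1,r^\alpha)$. Let $H^1(\Omega;w)$ be the space of $u\in L^2(\Omega)$ with weak gradient satisfying $\int_\Omega\nabla u\cdot A\nabla u\,dz<\infty$, with norm given by $\|u\|^2=\int_\Omega(u^2+\nabla u\cdot A\nabla u)\,dz$; let $H^1_\Gamma(\Omega;w)$ be the closure in $H^1(\Omega;w)$ of the functions in $C^\infty(\overline\Omega)$ that vanish near $\Gamma$; and let $H^2(\Omega;w)$ be the space of $u\in H^1(\Omega;w)$ with $\operatorname{div}(A\nabla u)\in L^2(\Omega)$. Let $g\in L^2(\Omega)$ and let $u$ be the weak solution of $$-\operatorname{div}(A\nabla u)=g\ \text{ in }\Omega,\qquad u=0\ \text{ on }\Gamma,\qquad \frac{\partial u}{\partial\nu_A}=0\ \text{ on }\Gamma^*,$$ that is, $u\in H^1_\Gamma(\Omega;w)\cap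 H^2(\Omega;w)$ and $\int_\Omega\nabla u\cdot A\nabla v\,dz=\int_\Omega gv\,dz$ for all $v\in H^1_\Gamma(\Omega;w)$. Then, with all boundary values understood in the sense of traces: (i) $\partial_\theta u=0$ on $\Gamma$; (ii) $r^{\alpha/2}u^2\in W^{1,1}(\Omega)$; for every $\epsilon\in[0,\frac{2-\alpha}4)$, with $\epsilon>0$ if $\alpha=1$, one has $r^{\alpha/2+\epsilon}u\in H^1(\Omega)$; and $ru^2=ru=0$ on $\Gamma^*$; (iii) $r(\nabla u\cdot A\nabla u)\in W^{1,1}(\Omega)$, and $r(\nabla u\cdot A\nabla u)=0$ on $\Gamma^*$. -/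

import Mathlib

open Set MeasureTheory Real
open scoped ENNReal ContDiff

namespace DegenerateCylinder

noncomputable section

instance instFactTwoPiPos : Fact (0 < 2 * π) := ⟨Real.two_pi_pos⟩

/-- The infinite cylinder `𝕋 × ℝ` with coordinates `z = (θ, r)`; the unit circle `𝕋` is
parametrised by the angle `θ ∈ ℝ / 2πℤ` and carries the arc length measure. -/
abbrev Cyl : Type := AddCircle (2 * π) × ℝ

/-- The domain `Ω = 𝕋 × (0, 1)`. -/
def Omega : Set Cyl := {z | 0 < z.2 ∧ z.2 < 1}

/-- The measure `dz = dθ dr` on `Ω`. -/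
def muOmega : Measure Cyl := volume.restrict Omega

/-- `∂_θ φ` for a differentiable function on the cylinder. -/
def dTheta (φ : Cyl → ℝ) (z : Cyl) : ℝ :=
  deriv (fun t : ℝ => φ (z.1 + (t : AddCircle (2 * π)), z.2)) 0

/-- `∂_r φ` for a differentiable function on the cylinder. -/
def dR (φ : Cyl → ℝ) (z : Cyl) : ℝ :=
  deriv (fun s : ℝ => φ (z.1, s)) z.2

/-- Smooth functions on the cylinder: those whose `2π`-periodic lift to `ℝ × ℝ` is `C^∞`. -/
def IsSmooth (φ : Cyl → ℝ) : Prop :=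
  ContDiff ℝ ∞ (fun x : ℝ × ℝ => φ ((x.1 : AddCircle (2 * π)), x.2))

/-- Test functions, `φ ∈ C_0^∞(Ω)`. -/
structure IsTest (φ : Cyl → ℝ) : Prop where
  smooth : IsSmooth φ
  compact : HasCompactSupport φ
  support : tsupport φ ⊆ Omega

/-- `φ` is (the smooth extension to the cylinder of) an element of `C_Γ^∞(Ω)`: smooth on the
closure of `Ω` and zero near `Γ = 𝕋 × {1}`. -/
structure IsSmoothGamma (φ : Cyl → ℝ) : Prop where
  smooth : IsSmooth φ
  vanish : ∃ δ > 0, ∀ z ∈ Omega, 1 - δ < z.2 → φ z = 0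

/-- `φ` is (the smooth extension to the cylinder of) a function smooth on the closure of `Ω` and
zero near `Γ^* = 𝕋 × {0}`. -/
structure IsSmoothGammaStar (φ : Cyl → ℝ) : Prop where
  smooth : IsSmooth φ
  vanish : ∃ δ > 0, ∀ z ∈ Omega, z.2 < δ → φ z = 0

/-- `∇u = (∂_θ u, ∂_r u) = (p, q)` in `Ω` in the sense of distributions, with
`u, p, q ∈ L^1_loc(Ω)`. -/
structure IsWeakGrad (u p q : Cyl → ℝ) : Prop where
  locInt : LocallyIntegrableOn u Omega
  locInt_theta : LocallyIntegrableOn p Omega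
  locInt_r : LocallyIntegrableOn q Omega
  theta : ∀ φ, IsTest φ → ∫ z, u z * dTheta φ z ∂muOmega = -∫ z, p z * φ z ∂muOmega
  r : ∀ φ, IsTest φ → ∫ z, u z * dR φ z ∂muOmega = -∫ z, q z * φ z ∂muOmega

/-- The Sobolev space `W^{1,m}(Ω)`; `H^1(Ω)` is the case `m = 2`. -/
def MemW1 (m : ℝ≥0∞) (f : Cyl → ℝ) : Prop :=
  MemLp f m muOmega ∧
    ∃ p q, IsWeakGrad f p q ∧ MemLp p m muOmega ∧ MemLp q m muOmega

/-- `u ∈ H^1(Ω; w)` with `w = r^α`, `A = diag(1, r^α)` and `∇u = (p, q)`: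
`u ∈ L^2(Ω)` and `∫_Ω ∇u · A∇u dz < ∞`. -/
structure IsH1w (α : ℝ) (u p q : Cyl → ℝ) : Prop where
  grad : IsWeakGrad u p q
  memLp : MemLp u 2 muOmega
  memLp_theta : MemLp p 2 muOmega
  memLp_r : MemLp (fun z => z.2 ^ (α / 2) * q z) 2 muOmega

/-- `u ∈ H_Γ^1(Ω; w)`, the closure of `C_Γ^∞(Ω)` in `H^1(Ω; w)`. -/
def MemH1Gamma (α : ℝ) (u : Cyl → ℝ) : Prop :=
  ∃ p q, IsH1w α u p q ∧ ∀ η > 0, ∃ φ, IsSmoothGamma φ ∧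
    ∫ z, ((u z - φ z) ^ 2 + (p z - dTheta φ z) ^ 2 + z.2 ^ α * (q z - dR φ z) ^ 2) ∂muOmega < η

/-- `u ∈ H^2(Ω; w)`: `u ∈ H^1(Ω; w)` and the distribution `-div(A∇u)` is a function
`h ∈ L^2(Ω)`. -/
def MemH2w (α : ℝ) (u : Cyl → ℝ) : Prop :=
  ∃ p q, IsH1w α u p q ∧ ∃ h, MemLp h 2 muOmega ∧ ∀ φ, IsTest φ →
    ∫ z, (p z * dTheta φ z + z.2 ^ α * (q z * dR φ z)) ∂muOmega = ∫ z, h z * φ z ∂muOmega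

/-- `u` is a weak solution of `-div(A∇u) = g` in `Ω`, `u = 0` on `Γ`, `∂u/∂ν_A = 0` on `Γ^*`:
`u ∈ H_Γ^1(Ω; w) ∩ H^2(Ω; w)` and `∫_Ω ∇u · A∇v dz = ∫_Ω g v dz` for all
`v ∈ H_Γ^1(Ω; w)`. -/
structure IsWeakSolution (α : ℝ) (g u : Cyl → ℝ) : Prop where
  memH1Gamma : MemH1Gamma α u
  memH2w : MemH2w α u
  weak : ∀ p q, IsWeakGrad u p q → ∀ v, MemH1Gamma α v → ∀ p' q', IsWeakGrad v p' q' →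
    ∫ z, (p z * p' z + z.2 ^ α * (q z * q' z)) ∂muOmega = ∫ z, g z * v z ∂muOmega

/-- `f` has the trace `h ∈ L^1(Γ)` on `Γ = 𝕋 × {1}`: `f` is `W^{1,1}` up to `Γ`
(that is, locally on `𝕋 × (0, 1]`), and the Gauss-Green formula
`∫_Ω (f ∂_r φ + (∂_r f) φ) dz = ∫_𝕋 h φ(·, 1) dθ` holds for every `φ` smooth up to the boundary
and zero near `Γ^*`. This determines `h` almost everywhere, and `h` is the limit of the
boundary values `f_n(·, 1)` for smooth `f_n → f` in `W^{1,1}` near `Γ`. -/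
def HasTraceGamma (f : Cyl → ℝ) (h : AddCircle (2 * π) → ℝ) : Prop :=
  Integrable h ∧ ∃ p q, IsWeakGrad f p q ∧
    LocallyIntegrableOn f {z | 0 < z.2 ∧ z.2 ≤ 1} ∧
    LocallyIntegrableOn p {z | 0 < z.2 ∧ z.2 ≤ 1} ∧
    LocallyIntegrableOn q {z | 0 < z.2 ∧ z.2 ≤ 1} ∧
    ∀ φ, IsSmoothGammaStar φ →
      ∫ z, (f z * dR φ z + q z * φ z) ∂muOmega = ∫ θ, h θ * φ (θ, 1)

/-- `f` has the trace `h ∈ L^1(Γ^*)` on `Γ^* = 𝕋 × {0}`: `f` is `W^{1,1}` up to `Γ^*`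
(that is, locally on `𝕋 × [0, 1)`), and the Gauss-Green formula
`∫_Ω (f ∂_r φ + (∂_r f) φ) dz = -∫_𝕋 h φ(·, 0) dθ` holds for every `φ` smooth up to the boundary
and zero near `Γ`. -/
def HasTraceGammaStar (f : Cyl → ℝ) (h : AddCircle (2 * π) → ℝ) : Prop :=
  Integrable h ∧ ∃ p q, IsWeakGrad f p q ∧
    LocallyIntegrableOn f {z | 0 ≤ z.2 ∧ z.2 < 1} ∧
    LocallyIntegrableOn p {z | 0 ≤ z.2 ∧ z.2 < 1} ∧
    LocallyIntegrableOn q {z | 0 ≤ z.2 ∧ z.2 < 1} ∧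
    ∀ φ, IsSmoothGamma φ →
      ∫ z, (f z * dR φ z + q z * φ z) ∂muOmega = -∫ θ, h θ * φ (θ, 0)

/-- `f = 0` on `Γ`, in the sense of traces. -/
def VanishesOnGamma (f : Cyl → ℝ) : Prop := HasTraceGamma f (fun _ => 0)

/-- `f = 0` on `Γ^*`, in the sense of traces. -/
def VanishesOnGammaStar (f : Cyl → ℝ) : Prop := HasTraceGammaStar f (fun _ => 0)

end

end DegenerateCylinder

open DegenerateCylinder

/-! Rotations in `θ` preserve `Ω`, `A` and `H^1_Γ`, so Nirenberg's difference quotients work in the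
tangential direction right up to both boundary circles. Write `∇u = (p, q)` and `D f` for the
increment of `f` under rotation by `t`. Testing the equation with the second difference of `u` gives
`‖D p‖² + ‖r^{α/2} D q‖² ≤ ‖g‖ |t| ‖D p‖`. Hence `P = ∂_θ p` and `R = r^{α/2} ∂_θ q` lie in `L²`,
and the equation becomes `∂_r (r^α q) = -(g + P)`, again in `L²` (`IsWeakSolution.regularity`). The
three claims follow from these facts.

(i) For `φ` zero near `Γ^*`, moving `∂_θ` onto `φ` turns the Gauss-Green integral of `p` against `φ`
into minus that of `u` against `∂_θ φ`. The latter is zero because `u` is a limit of functions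
vanishing near `Γ` (`IsH1Gamma.integral_eq_zero`).

(ii) The new term in `∂_r (r^κ u²)` or `∂_r (r^κ u)` is the one where the derivative falls on the
power; the inequality `hardy` makes it integrable, respectively square integrable.

(iii) The density is `r p² + r^{1-α} (r^α q)²`, and the gradients of `p` and of the flux `r^α q` are
under control. The product rule rests on the chain rule for squares `WD.sq_of_rpow`.

The traces on `Γ^*` all have the form `r F` with `F ∈ L^1` and `r F ∈ W^{1,1}`
(`vanishesOnGammaStar_mul`): for a cut-off at height `δ`, `r` times its derivative is bounded
uniformly in `δ` and tends to zero pointwise, so no boundary term survives. -/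

open Filter Topology

namespace DegenerateCylinder

noncomputable section

/-! ### Translations and directional derivatives on the cylinder -/

/-- The covering map `ℝ × ℝ → Cyl`. -/
def cover (x : ℝ × ℝ) : Cyl := ((x.1 : AddCircle (2 * π)), x.2)

/-- Translation of the cylinder by `t • e`. -/
def shift (e : ℝ × ℝ) (t : ℝ) (z : Cyl) : Cyl :=
  (z.1 + ((t * e.1 : ℝ) : AddCircle (2 * π)), z.2 + t * e.2)

/-- The derivative in the direction `e`. -/
def dE (e : ℝ × ℝ) (φ : Cyl → ℝ) (z : Cyl) : ℝ := deriv (fun t => φ (shift e t z)) 0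

theorem dTheta_eq (φ : Cyl → ℝ) : dTheta φ = dE (1, 0) φ := by
  funext z; simp [dTheta, dE, shift]

theorem dR_eq (φ : Cyl → ℝ) : dR φ = dE (0, 1) φ := by
  funext z
  simp only [dR, dE, shift, mul_zero, mul_one]
  have := deriv_comp_const_add (f := fun s : ℝ => φ (z.1, s)) z.2 0
  simp only [add_zero] at this
  simp [this]

theorem cover_surjective : Function.Surjective cover := by
  rintro ⟨a, r⟩
  obtain ⟨x, rfl⟩ := QuotientAddGroup.mk_surjective a
  exact ⟨(x, r), rfl⟩

theorem continuous_cover : Continuous cover :=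
  ((AddCircle.continuous_mk' _).comp continuous_fst).prodMk continuous_snd

theorem isOpenMap_cover : IsOpenMap cover := by
  have : IsOpenMap (fun x : ℝ => (x : AddCircle (2 * π))) := QuotientAddGroup.isOpenMap_coe
  exact this.prodMap IsOpenMap.id

theorem isQuotientMap_cover : IsQuotientMap cover :=
  isOpenMap_cover.isQuotientMap continuous_cover cover_surjective

theorem shift_cover (e : ℝ × ℝ) (t : ℝ) (x : ℝ × ℝ) :
    shift e t (cover x) = cover (x + t • e) := by
  simp [shift, cover]

theorem shift_zero (e : ℝ × ℝ) (z : Cyl) : shift e 0 z = z := by simp [shift]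

theorem shift_shift (e : ℝ × ℝ) (s t : ℝ) (z : Cyl) :
    shift e s (shift e t z) = shift e (t + s) z := by
  obtain ⟨x, rfl⟩ := cover_surjective z
  simp only [shift_cover, add_smul, add_assoc]

theorem continuous_shift (e : ℝ × ℝ) (t : ℝ) : Continuous (shift e t) := by
  unfold shift; fun_prop

theorem continuous_shift_time (e : ℝ × ℝ) (z : Cyl) : Continuous (fun t => shift e t z) := by
  obtain ⟨x, rfl⟩ := cover_surjective z
  simp only [shift_cover]
  exact continuous_cover.comp (by fun_prop)

theorem isSmooth_iff {φ : Cyl → ℝ} : IsSmooth φ ↔ ContDiff ℝ ∞ (φ ∘ cover) := Iff.rfl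

theorem IsSmooth.continuous {φ : Cyl → ℝ} (h : IsSmooth φ) : Continuous φ :=
  isQuotientMap_cover.continuous_iff.2 (isSmooth_iff.1 h).continuous

theorem IsSmooth.hasDerivAt_cover {φ : Cyl → ℝ} (h : IsSmooth φ) (e x : ℝ × ℝ) :
    HasDerivAt (fun t => φ (shift e t (cover x))) (fderiv ℝ (φ ∘ cover) x e) 0 := by
  have h1 : HasFDerivAt (φ ∘ cover) (fderiv ℝ (φ ∘ cover) x) (x + (0 : ℝ) • e) := by
    simpa using ((isSmooth_iff.1 h).differentiable (by simp) x).hasFDerivAt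
  have h2 : HasDerivAt (fun t : ℝ => x + t • e) e 0 := by
    simpa using ((hasDerivAt_id (0 : ℝ)).smul_const e).const_add x
  simpa only [shift_cover] using! h1.comp_hasDerivAt (f := fun t : ℝ => x + t • e) (0 : ℝ) h2

theorem IsSmooth.dE_cover {φ : Cyl → ℝ} (h : IsSmooth φ) (e x : ℝ × ℝ) :
    dE e φ (cover x) = fderiv ℝ (φ ∘ cover) x e :=
  (h.hasDerivAt_cover e x).deriv

theorem IsSmooth.dE {φ : Cyl → ℝ} (h : IsSmooth φ) (e : ℝ × ℝ) : IsSmooth (dE e φ) := by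
  rw [isSmooth_iff]
  have : DegenerateCylinder.dE e φ ∘ cover = fun x => fderiv ℝ (φ ∘ cover) x e := by
    funext x; exact h.dE_cover e x
  rw [this]
  have h1 : ContDiff ℝ ∞ (fderiv ℝ (φ ∘ cover)) := (isSmooth_iff.1 h).fderiv_right (by simp)
  exact h1.clm_apply contDiff_const

theorem IsSmooth.hasDerivAt_shift {φ : Cyl → ℝ} (h : IsSmooth φ) (e : ℝ × ℝ) (z : Cyl) (t : ℝ) :
    HasDerivAt (fun t => φ (shift e t z)) (DegenerateCylinder.dE e φ (shift e t z)) t := by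
  obtain ⟨x, hx⟩ := cover_surjective (shift e t z)
  have h1 : HasDerivAt (fun s => φ (shift e s (shift e t z)))
      (DegenerateCylinder.dE e φ (shift e t z)) (t - t) := by
    rw [← hx, h.dE_cover, sub_self]; exact h.hasDerivAt_cover e x
  have h2 := h1.comp_sub_const t t
  simpa [shift_shift] using h2

theorem IsSmooth.hasDerivAt_zero {φ : Cyl → ℝ} (h : IsSmooth φ) (e : ℝ × ℝ) (z : Cyl) :
    HasDerivAt (fun t => φ (shift e t z)) (DegenerateCylinder.dE e φ z) 0 := by
  simpa [shift_zero] using h.hasDerivAt_shift e z 0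

theorem isSmooth_const (c : ℝ) : IsSmooth (fun _ => c) := by
  unfold IsSmooth; exact contDiff_const

theorem IsSmooth.mul {φ ψ : Cyl → ℝ} (h : IsSmooth φ) (h' : IsSmooth ψ) :
    IsSmooth (fun z => φ z * ψ z) := ContDiff.mul h h'

theorem IsSmooth.add {φ ψ : Cyl → ℝ} (h : IsSmooth φ) (h' : IsSmooth ψ) :
    IsSmooth (fun z => φ z + ψ z) := ContDiff.add h h'

theorem isSmooth_snd {ψ : ℝ → ℝ} (h : ContDiff ℝ ∞ ψ) : IsSmooth (fun z => ψ z.2) := by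
  unfold IsSmooth; exact h.comp contDiff_snd

theorem IsSmooth.comp_shift {φ : Cyl → ℝ} (h : IsSmooth φ) (e : ℝ × ℝ) (t : ℝ) :
    IsSmooth (fun z => φ (shift e t z)) := by
  have : (fun z => φ (shift e t z)) ∘ cover = fun x => (φ ∘ cover) (x + t • e) := by
    funext x; simp [shift_cover]
  rw [isSmooth_iff, this]
  exact (isSmooth_iff.1 h).comp (by fun_prop)

theorem dE_comp_shift (φ : Cyl → ℝ) (e e' : ℝ × ℝ) (t : ℝ) (z : Cyl) :
    dE e (fun z => φ (shift e' t z)) z = dE e φ (shift e' t z) := by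
  obtain ⟨x, rfl⟩ := cover_surjective z
  simp only [dE, shift_cover, add_right_comm]

theorem dE_mul {φ ψ : Cyl → ℝ} (h : IsSmooth φ) (h' : IsSmooth ψ) (e : ℝ × ℝ) (z : Cyl) :
    dE e (fun z => φ z * ψ z) z = dE e φ z * ψ z + φ z * dE e ψ z := by
  have := ((h.hasDerivAt_zero e z).mul (h'.hasDerivAt_zero e z)).deriv
  simpa [shift_zero, Pi.mul_def, dE] using! this

theorem dE_add {φ ψ : Cyl → ℝ} (h : IsSmooth φ) (h' : IsSmooth ψ) (e : ℝ × ℝ) (z : Cyl) :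
    dE e (fun z => φ z + ψ z) z = dE e φ z + dE e ψ z :=
  ((h.hasDerivAt_zero e z).add (h'.hasDerivAt_zero e z)).deriv

theorem dE_const (c : ℝ) (e : ℝ × ℝ) (z : Cyl) : dE e (fun _ => c) z = 0 := by simp [dE]

theorem dE_const_mul {φ : Cyl → ℝ} (h : IsSmooth φ) (c : ℝ) (e : ℝ × ℝ) (z : Cyl) :
    dE e (fun z => c * φ z) z = c * dE e φ z := by
  simp [dE_mul (isSmooth_const c) h, dE_const]

theorem dE_snd {ψ : ℝ → ℝ} (h : Differentiable ℝ ψ) (e : ℝ × ℝ) (z : Cyl) :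
    dE e (fun z => ψ z.2) z = e.2 * deriv ψ z.2 := by
  have h1 : HasDerivAt (fun t : ℝ => z.2 + t * e.2) e.2 0 := by
    simpa using ((hasDerivAt_id (0 : ℝ)).mul_const e.2).const_add z.2
  have h2 : HasDerivAt ψ (deriv ψ z.2) (z.2 + 0 * e.2) := by simpa using (h z.2).hasDerivAt
  have := (h2.comp (h := fun t : ℝ => z.2 + t * e.2) (0 : ℝ) h1).deriv
  simpa [mul_comm, dE, shift, Function.comp_def] using this

/-- Symmetry of the second derivative of the lift. It is what lets weak `∂_θ` and `∂_r` be exchanged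
through test functions. -/
theorem dE_comm {φ : Cyl → ℝ} (h : IsSmooth φ) (e e' : ℝ × ℝ) (z : Cyl) :
    dE e (dE e' φ) z = dE e' (dE e φ) z := by
  obtain ⟨x, rfl⟩ := cover_surjective z
  have hs := isSmooth_iff.1 h
  have key : ∀ e e' : ℝ × ℝ, dE e (dE e' φ) (cover x)
      = fderiv ℝ (fderiv ℝ (φ ∘ cover)) x e e' := by
    intro e e'
    rw [(h.dE e').dE_cover]
    have : dE e' φ ∘ cover = fun x => fderiv ℝ (φ ∘ cover) x e' := by
      funext x; exact h.dE_cover e' x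
    rw [this, fderiv_clm_apply]
    · simp
    · exact (hs.fderiv_right (m := ∞) (by simp)).differentiable (by simp) x
    · exact differentiableAt_const _
  rw [key, key]
  exact ((hs.of_le (m := 2) (by norm_cast)).contDiffAt.isSymmSndFDerivAt (by simp)) e e'

/-! ### Test functions and translation-invariant sets -/

/-- Smooth functions with compact support in `U`. -/
structure IsTestIn (U : Set Cyl) (φ : Cyl → ℝ) : Prop where
  smooth : IsSmooth φ
  compact : HasCompactSupport φ
  support : tsupport φ ⊆ U

theorem isTestIn_Omega {φ : Cyl → ℝ} : IsTestIn Omega φ ↔ IsTest φ :=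
  ⟨fun h => ⟨h.1, h.2, h.3⟩, fun h => ⟨h.1, h.2, h.3⟩⟩

theorem eq_zero_of_eventuallyEq {φ : Cyl → ℝ} {z : Cyl} (h : φ =ᶠ[𝓝 z] 0) (e : ℝ × ℝ) :
    dE e φ z = 0 := by
  have : (fun t => φ (shift e t z)) =ᶠ[𝓝 0] fun _ => 0 := by
    have hc := (continuous_shift_time e z).tendsto 0
    rw [shift_zero] at hc
    exact hc.eventually h
  simpa [dE] using this.deriv_eq

theorem tsupport_dE_subset (φ : Cyl → ℝ) (e : ℝ × ℝ) : tsupport (dE e φ) ⊆ tsupport φ := by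
  refine closure_minimal (fun z hz => ?_) (isClosed_tsupport φ)
  by_contra hc
  exact hz (eq_zero_of_eventuallyEq (notMem_tsupport_iff_eventuallyEq.1 hc) e)

theorem IsTestIn.dE {U : Set Cyl} {φ : Cyl → ℝ} (h : IsTestIn U φ) (e : ℝ × ℝ) :
    IsTestIn U (dE e φ) :=
  ⟨h.smooth.dE e, h.compact.of_isClosed_subset (isClosed_tsupport _) (tsupport_dE_subset φ e),
    (tsupport_dE_subset φ e).trans h.support⟩

theorem IsTestIn.mul_left {U : Set Cyl} {φ ψ : Cyl → ℝ} (h : IsTestIn U φ) (h' : IsSmooth ψ) :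
    IsTestIn U (fun z => ψ z * φ z) :=
  ⟨h'.mul h.smooth, h.compact.mul_left, (tsupport_mul_subset_right).trans h.support⟩

theorem IsTestIn.add {U : Set Cyl} {φ ψ : Cyl → ℝ} (h : IsTestIn U φ) (h' : IsTestIn U ψ) :
    IsTestIn U (fun z => φ z + ψ z) :=
  ⟨h.smooth.add h'.smooth, h.compact.add h'.compact,
    (tsupport_add φ ψ).trans (union_subset h.support h'.support)⟩

theorem IsTestIn.mono {U V : Set Cyl} {φ : Cyl → ℝ} (h : IsTestIn U φ) (hUV : U ⊆ V) :
    IsTestIn V φ := ⟨h.smooth, h.compact, h.support.trans hUV⟩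

/-- Translation as a homeomorphism. -/
def shiftHomeo (e : ℝ × ℝ) (t : ℝ) : Cyl ≃ₜ Cyl where
  toFun := shift e t
  invFun := shift e (-t)
  left_inv z := by simp [shift_shift, shift_zero]
  right_inv z := by simp [shift_shift, shift_zero]
  continuous_toFun := continuous_shift e t
  continuous_invFun := continuous_shift e (-t)

/-- `U` is invariant under the translations in the direction `e`. -/
def ShiftInvariant (e : ℝ × ℝ) (U : Set Cyl) : Prop := ∀ t z, shift e t z ∈ U ↔ z ∈ U

theorem shiftInvariant_univ (e : ℝ × ℝ) : ShiftInvariant e univ := fun _ _ => Iff.rfl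

/-- `Ω` is invariant in the tangential direction only, while the whole cylinder is invariant in
every direction; radial statements are therefore reduced to the whole cylinder. -/
theorem shiftInvariant_Omega : ShiftInvariant (1, 0) Omega := fun t z => by
  simp [shift, Omega]

theorem IsTestIn.comp_shift {U : Set Cyl} {e : ℝ × ℝ} (hU : ShiftInvariant e U) {φ : Cyl → ℝ}
    (h : IsTestIn U φ) (t : ℝ) : IsTestIn U (fun z => φ (shift e t z)) := by
  refine ⟨h.smooth.comp_shift e t, h.compact.comp_homeomorph (shiftHomeo e t), ?_⟩
  intro z hz
  have : shift e t z ∈ tsupport φ :=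
    tsupport_comp_subset_preimage φ (continuous_shift e t) hz
  exact (hU t z).1 (h.support this)

theorem measurePreserving_shift (e : ℝ × ℝ) (t : ℝ) :
    MeasurePreserving (shift e t) (volume : Measure Cyl) volume :=
  (measurePreserving_add_right volume ((t * e.1 : ℝ) : AddCircle (2 * π))).prod
    (measurePreserving_add_right volume (t * e.2))

theorem measurePreserving_shift_restrict {e : ℝ × ℝ} {U : Set Cyl} (hU : ShiftInvariant e U)
    (t : ℝ) : MeasurePreserving (shift e t) (volume.restrict U) (volume.restrict U) := by
  have := (measurePreserving_shift e t).restrict_preimage_emb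
    (shiftHomeo e t).measurableEmbedding U
  have h : shift e t ⁻¹' U = U := by ext z; exact hU t z
  rwa [h] at this

theorem integral_comp_shift {e : ℝ × ℝ} {U : Set Cyl} (hU : ShiftInvariant e U) (t : ℝ)
    (f : Cyl → ℝ) : ∫ z in U, f (shift e t z) = ∫ z in U, f z :=
  (measurePreserving_shift_restrict hU t).integral_comp (shiftHomeo e t).measurableEmbedding f

theorem isOpen_Omega : IsOpen Omega :=
  (isOpen_lt continuous_const continuous_snd).inter (isOpen_lt continuous_snd continuous_const)

theorem measurableSet_Omega : MeasurableSet Omega := isOpen_Omega.measurableSet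

/-! ### Fundamental lemma, density and duality in `L²` -/

open scoped Manifold in
/-- The fundamental lemma of the calculus of variations on the cylinder. -/
theorem ae_eq_zero_of_integral_test {U : Set Cyl} (hU : IsOpen U) {f : Cyl → ℝ}
    (hf : LocallyIntegrableOn f U)
    (h : ∀ φ, IsTestIn U φ → ∫ z in U, f z * φ z = 0) : f =ᵐ[volume.restrict U] 0 := by
  let _ : MeasurableSpace (Circle × ℝ) := borel _
  have : BorelSpace (Circle × ℝ) := ⟨rfl⟩
  -- The fundamental lemma for manifolds is applied on `Circle × ℝ`, with the pushed-forward
  -- measure.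
  let Φ : Cyl ≃ₜ Circle × ℝ := AddCircle.homeomorphCircle'.prodCongr (Homeomorph.refl ℝ)
  have hΦ : ∀ x : ℝ × ℝ, Φ (cover x) = (Circle.exp x.1, x.2) := fun x => by
    simp [Φ, cover, AddCircle.homeomorphCircle'_apply_mk]
  let V : Set (Circle × ℝ) := Φ.symm ⁻¹' U
  have hV : IsOpen V := hU.preimage Φ.symm.continuous
  have hVU : Φ ⁻¹' V = U := by ext z; simp [V]
  have hemb := Φ.measurableEmbedding
  have hF : LocallyIntegrableOn (f ∘ Φ.symm) V (volume.map Φ) := by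
    intro y hy
    obtain ⟨s, hs, hi⟩ := hf (Φ.symm y) hy
    rw [hU.nhdsWithin_eq hy] at hs
    refine ⟨Φ.symm ⁻¹' s, mem_nhdsWithin_of_mem_nhds (Φ.symm.continuous.continuousAt hs), ?_⟩
    rw [hemb.integrableOn_map_iff]
    convert hi using 1
    · funext z; simp
    · ext z; simp
  have key := hV.ae_eq_zero_of_integral_contMDiff_smul_eq_zero ((𝓡 1).prod 𝓘(ℝ, ℝ)) hF
    (fun ψ hψ hc hs => ?_)
  · rw [hemb.ae_map_iff] at key
    rw [Filter.EventuallyEq, ae_restrict_iff' hU.measurableSet]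
    filter_upwards [key] with z hz hzU
    have := hz (by simpa [V] using hzU)
    simpa using this
  · rw [hemb.integral_map]
    have ht : IsTestIn U (ψ ∘ Φ) := by
      refine ⟨?_, hc.comp_homeomorph Φ, fun z hz => ?_⟩
      · have h1 : ContMDiff 𝓘(ℝ, ℝ × ℝ) ((𝓡 1).prod 𝓘(ℝ, ℝ)) ∞
            (fun x : ℝ × ℝ => (Circle.exp x.1, x.2)) :=
          (contMDiff_circleExp.comp contDiff_fst.contMDiff).prodMk contDiff_snd.contMDiff
        have h2 := (hψ.comp h1).contDiff
        rw [isSmooth_iff]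
        convert h2 using 1
        funext x
        simp [hΦ]
      · have : Φ z ∈ tsupport ψ := tsupport_comp_subset_preimage ψ Φ.continuous hz
        simpa [V] using hs this
    have h3 := h _ ht
    rw [setIntegral_eq_integral_of_forall_compl_eq_zero (fun z hz => ?_)] at h3
    · rw [← h3]; congr 1; funext z; simp [mul_comm]
    · have : z ∉ tsupport (ψ ∘ Φ) := fun hc => hz (ht.support hc)
      simp [-Function.comp_apply, image_eq_zero_of_notMem_tsupport this]

theorem IsTestIn.continuous {U : Set Cyl} {φ : Cyl → ℝ} (h : IsTestIn U φ) : Continuous φ :=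
  h.smooth.continuous

theorem IsTestIn.memLp {U V : Set Cyl} {φ : Cyl → ℝ} (h : IsTestIn U φ) (m : ℝ≥0∞) :
    MemLp φ m (volume.restrict V) :=
  h.continuous.memLp_of_hasCompactSupport h.compact

theorem IsTestIn.exists_bound {U : Set Cyl} {φ : Cyl → ℝ} (h : IsTestIn U φ) :
    ∃ C, 0 ≤ C ∧ ∀ z, |φ z| ≤ C := by
  obtain ⟨C, hC⟩ := h.compact.exists_bound_of_continuous h.continuous
  exact ⟨max C 0, le_max_right _ _, fun z => (hC z).trans (le_max_left _ _)⟩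

theorem integrable_mul_of_memLp {μ : Measure Cyl} {f g : Cyl → ℝ} (hf : MemLp f 2 μ)
    (hg : MemLp g 2 μ) : Integrable (fun z => f z * g z) μ := hf.integrable_mul hg

theorem integral_add_add {μ : Measure Cyl} {f g h : Cyl → ℝ} (hf : Integrable f μ)
    (hg : Integrable g μ) (hh : Integrable h μ) :
    ∫ z, (f z + g z + h z) ∂μ = (∫ z, f z ∂μ) + (∫ z, g z ∂μ) + ∫ z, h z ∂μ := by
  rw [← integral_add hf hg]
  exact integral_add (hf.add hg) hh

theorem memLp_sub {μ : Measure Cyl} {m : ℝ≥0∞} {f g : Cyl → ℝ} (hf : MemLp f m μ)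
    (hg : MemLp g m μ) : MemLp (fun z => f z - g z) m μ := hf.sub hg

/-- `L²` norm on `U`. -/
def n2 (U : Set Cyl) (f : Cyl → ℝ) : ℝ := √(∫ z in U, f z ^ 2)

theorem n2_nonneg (U : Set Cyl) (f : Cyl → ℝ) : 0 ≤ n2 U f := Real.sqrt_nonneg _

theorem n2_sq (U : Set Cyl) (f : Cyl → ℝ) : n2 U f ^ 2 = ∫ z in U, f z ^ 2 :=
  Real.sq_sqrt (integral_nonneg fun _ => sq_nonneg _)

theorem norm_toLp_eq {U : Set Cyl} {f : Cyl → ℝ} (hf : MemLp f 2 (volume.restrict U)) :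
    ‖hf.toLp f‖ = n2 U f := by
  have h1 : ‖hf.toLp f‖ ^ 2 = n2 U f ^ 2 := by
    rw [n2_sq, ← real_inner_self_eq_norm_sq, L2.inner_def]
    refine integral_congr_ae ?_
    filter_upwards [hf.coeFn_toLp] with z hz
    simp [hz, sq]
  exact (sq_eq_sq₀ (norm_nonneg _) (n2_nonneg _ _)).1 h1

theorem inner_toLp_eq {U : Set Cyl} {f g : Cyl → ℝ} (hf : MemLp f 2 (volume.restrict U))
    (hg : MemLp g 2 (volume.restrict U)) :
    inner ℝ (hf.toLp f) (hg.toLp g) = ∫ z in U, f z * g z := by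
  rw [L2.inner_def]
  refine integral_congr_ae ?_
  filter_upwards [hf.coeFn_toLp, hg.coeFn_toLp] with z hz hz'
  simp [hz, hz', mul_comm]

theorem abs_integral_mul_le {U : Set Cyl} {f g : Cyl → ℝ} (hf : MemLp f 2 (volume.restrict U))
    (hg : MemLp g 2 (volume.restrict U)) : |∫ z in U, f z * g z| ≤ n2 U f * n2 U g := by
  rw [← inner_toLp_eq hf hg, ← norm_toLp_eq hf, ← norm_toLp_eq hg]
  exact abs_real_inner_le_norm _ _

theorem n2_sub_le {U : Set Cyl} {f g : Cyl → ℝ} (hf : MemLp f 2 (volume.restrict U))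
    (hg : MemLp g 2 (volume.restrict U)) : n2 U (fun z => f z - g z) ≤ n2 U f + n2 U g := by
  have h := norm_sub_le (hf.toLp f) (hg.toLp g)
  rw [← MemLp.toLp_sub, norm_toLp_eq, norm_toLp_eq, norm_toLp_eq] at h
  exact h

theorem n2_const_mul (U : Set Cyl) (c : ℝ) (f : Cyl → ℝ) :
    n2 U (fun z => c * f z) = |c| * n2 U f := by
  simp only [n2, mul_pow, integral_const_mul]
  rw [Real.sqrt_mul (sq_nonneg c), Real.sqrt_sq_eq_abs]

/-- Test functions are dense in `L²`. -/
theorem exists_test_n2_sub_lt {U : Set Cyl} (hU : IsOpen U) {f : Cyl → ℝ}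
    (hf : MemLp f 2 (volume.restrict U)) {η : ℝ} (hη : 0 < η) :
    ∃ φ, IsTestIn U φ ∧ n2 U (fun z => f z - φ z) < η := by
  -- The classes of test functions form a subspace; a class orthogonal to it is zero by the
  -- fundamental lemma, so the subspace is dense.
  let S : Submodule ℝ (Lp ℝ 2 (volume.restrict U)) :=
    Submodule.span ℝ {x | ∃ φ, ∃ h : IsTestIn U φ, x = (h.memLp (V := U) 2).toLp φ}
  have hS : ∀ x ∈ S, ∃ φ, ∃ h : IsTestIn U φ, x = (h.memLp (V := U) 2).toLp φ := by
    intro x hx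
    refine Submodule.span_induction (fun x hx => hx) ?_ ?_ ?_ hx
    · refine ⟨fun _ => 0, ⟨isSmooth_const 0, HasCompactSupport.zero, ?_⟩, ?_⟩
      · simp [tsupport]
      · exact (MemLp.toLp_zero (MemLp.zero' )).symm
    · rintro x y _ _ ⟨φ, h, rfl⟩ ⟨ψ, h', rfl⟩
      exact ⟨_, h.add h', (MemLp.toLp_add _ _).symm⟩
    · rintro c x _ ⟨φ, h, rfl⟩
      exact ⟨_, h.mul_left (isSmooth_const c), (MemLp.toLp_const_smul c _).symm⟩
  have hd : S.topologicalClosure = ⊤ := by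
    rw [Submodule.topologicalClosure_eq_top_iff, Submodule.eq_bot_iff]
    intro x hx
    have hx2 : MemLp x 2 (volume.restrict U) := Lp.memLp x
    have h0 : (x : Cyl → ℝ) =ᵐ[volume.restrict U] 0 := by
      refine ae_eq_zero_of_integral_test hU ?_ fun φ h => ?_
      · have : LocallyIntegrable (x : Cyl → ℝ) (volume.restrict U) :=
          hx2.locallyIntegrable (by norm_num)
        exact locallyIntegrableOn_of_locallyIntegrable_restrict this
      · have h1 := (Submodule.mem_orthogonal S x).1 hx _ (Submodule.subset_span ⟨φ, h, rfl⟩)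
        rw [← Lp.toLp_coeFn x hx2, inner_toLp_eq] at h1
        rw [← h1]; congr 1; funext z; ring
    exact (Lp.eq_zero_iff_ae_eq_zero).2 h0
  have hmem : hf.toLp f ∈ closure (S : Set (Lp ℝ 2 (volume.restrict U))) := by
    rw [← Submodule.topologicalClosure_coe, hd]; trivial
  obtain ⟨y, hy, hlt⟩ := Metric.mem_closure_iff.1 hmem η hη
  obtain ⟨φ, h, rfl⟩ := hS y hy
  refine ⟨φ, h, ?_⟩
  rw [dist_eq_norm, ← MemLp.toLp_sub, norm_toLp_eq] at hlt
  exact hlt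

/-- A bound of an `L²` function by duality with test functions. -/
theorem n2_le_of_test {U : Set Cyl} (hU : IsOpen U) {f : Cyl → ℝ}
    (hf : MemLp f 2 (volume.restrict U)) {C : ℝ} (hC : 0 ≤ C)
    (h : ∀ φ, IsTestIn U φ → |∫ z in U, f z * φ z| ≤ C * n2 U φ) : n2 U f ≤ C := by
  by_contra! hlt
  -- Split `∫ f² = ∫ f φ + ∫ f (f - φ)` with a test function `φ` within `η` of `f`; as `η → 0` this
  -- yields `‖f‖² ≤ C ‖f‖`.
  have key : ∀ η > 0, n2 U f ^ 2 ≤ C * (n2 U f + η) + n2 U f * η := by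
    intro η hη
    obtain ⟨φ, hφ, hn⟩ := exists_test_n2_sub_lt hU hf hη
    have hφ2 := hφ.memLp (V := U) 2
    have h1 := h φ hφ
    have h2 := abs_integral_mul_le hf (hf.sub hφ2)
    have h3 : n2 U φ ≤ n2 U f + η := by
      have := n2_sub_le hf (hf.sub hφ2)
      simp only [Pi.sub_apply, sub_sub_cancel] at this
      exact this.trans (by gcongr; exact hn.le)
    have h4 : n2 U f ^ 2 = (∫ z in U, f z * φ z) + ∫ z in U, f z * (f - φ) z := by
      rw [n2_sq, ← integral_add]
      · congr 1; funext z; simp; ring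
      · exact hf.integrable_mul hφ2
      · exact hf.integrable_mul (hf.sub hφ2)
    rw [h4]
    refine add_le_add ((le_abs_self _).trans (h1.trans (by gcongr))) ((le_abs_self _).trans (h2.trans ?_))
    exact mul_le_mul_of_nonneg_left hn.le (n2_nonneg _ _)
  have h5 : n2 U f ^ 2 ≤ C * n2 U f := by
    refine le_of_forall_pos_le_add fun ε hε => ?_
    have hp : 0 < C + n2 U f + 1 := by have := n2_nonneg U f; linarith
    have := key (ε / (C + n2 U f + 1)) (by positivity)
    have h6 : (C + n2 U f) * (ε / (C + n2 U f + 1)) ≤ ε := by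
      rw [← mul_div_assoc, div_le_iff₀ hp]; nlinarith
    nlinarith
  nlinarith [n2_nonneg U f]

/-- Bounded sequences in a Hilbert space have a weak limit along an ultrafilter. -/
theorem exists_weak_limit {H : Type*} [NormedAddCommGroup H] [InnerProductSpace ℝ H]
    [CompleteSpace H] {x : ℕ → H} {C : ℝ} (hx : ∀ n, ‖x n‖ ≤ C) :
    ∃ y : H, ∀ v, Tendsto (fun n => inner ℝ (x n) v) (hyperfilter ℕ : Filter ℕ)
      (𝓝 (inner ℝ y v)) := by
  -- Banach-Alaoglu in the dual, identified with `H` by Riesz; a limit along an ultrafilter needs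
  -- neither subsequences nor separability.
  let T : H → WeakDual ℝ H := fun x => StrongDual.toWeakDual (InnerProductSpace.toDual ℝ H x)
  have hc := WeakDual.isCompact_closedBall (𝕜 := ℝ) (E := H) 0 C
  obtain ⟨ℓ, -, hℓ⟩ := hc.ultrafilter_le_nhds ((hyperfilter ℕ).map (T ∘ x)) (by
    rw [le_principal_iff]
    refine Eventually.of_forall (f := (hyperfilter ℕ : Filter ℕ)) fun n => ?_
    simpa [T] using hx n)
  refine ⟨(InnerProductSpace.toDual ℝ H).symm (WeakDual.toStrongDual ℓ), fun v => ?_⟩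
  have h1 : Tendsto (fun n => T (x n) v) (hyperfilter ℕ : Filter ℕ) (𝓝 (ℓ v)) :=
    (WeakDual.eval_continuous v).continuousAt.tendsto.comp hℓ
  simpa [T] using h1

/-! ### Weak directional derivatives and difference quotients -/

/-- `P` is the weak derivative of `f` in the direction `e` in `U`. -/
def WD (e : ℝ × ℝ) (U : Set Cyl) (f P : Cyl → ℝ) : Prop :=
  ∀ φ, IsTestIn U φ → ∫ z in U, f z * dE e φ z = -∫ z in U, P z * φ z

theorem continuous_shift_uncurry (e : ℝ × ℝ) :
    Continuous (fun x : ℝ × Cyl => shift e x.1 x.2) := by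
  have : Continuous (fun x : ℝ => (x : AddCircle (2 * π))) := AddCircle.continuous_mk' _
  unfold shift
  exact ((continuous_fst.comp continuous_snd).add (this.comp (by fun_prop))).prodMk (by fun_prop)

/-- Differentiation under the integral sign: at times within `1` of `t` the translated test
functions live in one compact set `K`, on which `f` is integrable, and `dE e φ` is bounded. -/
theorem hasDerivAt_integral_shift {U : Set Cyl} (e : ℝ × ℝ) {f φ : Cyl → ℝ}
    (hf : LocallyIntegrable f (volume.restrict U)) (hφ : IsTestIn U φ) (t : ℝ) :
    HasDerivAt (fun t => ∫ z in U, f z * φ (shift e t z))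
      (∫ z in U, f z * dE e φ (shift e t z)) t := by
  obtain ⟨C, hC0, hC⟩ := (hφ.dE e).exists_bound
  let K : Set Cyl := (fun x : ℝ × Cyl => shift e x.1 x.2) '' (Icc (-(t + 1)) (-(t - 1)) ×ˢ tsupport φ)
  have hK : IsCompact K := (isCompact_Icc.prod hφ.compact).image (continuous_shift_uncurry e)
  have hKs : ∀ s ∈ Metric.ball t 1, ∀ z, z ∉ K → shift e s z ∉ tsupport φ := by
    intro s hs z hz hc
    rw [Metric.mem_ball, Real.dist_eq, abs_lt] at hs
    exact hz ⟨(-s, shift e s z), ⟨⟨by simp; linarith, by simp; linarith⟩, hc⟩,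
      by simp [shift_shift, shift_zero]⟩
  have hfK : IntegrableOn f K (volume.restrict U) := hf.integrableOn_isCompact hK
  have hzero : ∀ s ∈ Metric.ball t 1, ∀ z, z ∉ K → dE e φ (shift e s z) = 0 := fun s hs z hz =>
    image_eq_zero_of_notMem_tsupport fun hc => hKs s hs z hz (tsupport_dE_subset φ e hc)
  have hm : AEStronglyMeasurable f (volume.restrict U) := hf.aestronglyMeasurable
  have hmf : ∀ s, AEStronglyMeasurable (fun z => f z * φ (shift e s z)) (volume.restrict U) :=
    fun s => hm.mul (hφ.continuous.comp (continuous_shift e s)).aestronglyMeasurable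
  have hm' : ∀ s, AEStronglyMeasurable (fun z => f z * dE e φ (shift e s z)) (volume.restrict U) :=
    fun s => hm.mul ((hφ.dE e).continuous.comp (continuous_shift e s)).aestronglyMeasurable
  refine (hasDerivAt_integral_of_dominated_loc_of_deriv_le
    (F' := fun s z => f z * dE e φ (shift e s z))
    (bound := fun z => C * K.indicator (fun z => |f z|) z)
    (Metric.ball_mem_nhds t one_pos) (Eventually.of_forall hmf) ?_ (hm' t) ?_ ?_ ?_).2
  · obtain ⟨D, hD0, hD⟩ := hφ.exists_bound
    have hI : Integrable (fun z => D * K.indicator (fun z => |f z|) z) (volume.restrict U) :=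
      ((integrable_indicator_iff hK.measurableSet).2 hfK.abs).const_mul D
    refine hI.mono' (hmf t) (Eventually.of_forall fun z => ?_)
    by_cases hz : z ∈ K
    · rw [indicator_of_mem hz, norm_mul, mul_comm D]
      exact mul_le_mul_of_nonneg_left (hD _) (norm_nonneg _)
    · rw [image_eq_zero_of_notMem_tsupport (hKs t (Metric.mem_ball_self one_pos) z hz)]
      simp [hz]
  · refine Eventually.of_forall fun z s hs => ?_
    by_cases hz : z ∈ K
    · rw [indicator_of_mem hz, norm_mul, mul_comm C]
      exact mul_le_mul_of_nonneg_left (hC _) (norm_nonneg _)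
    · rw [hzero s hs z hz]
      simp [hz]
  · exact ((integrable_indicator_iff hK.measurableSet).2 hfK.abs).const_mul C
  · exact Eventually.of_forall fun z s _ => (hφ.smooth.hasDerivAt_shift e z s).const_mul _

section

variable {e : ℝ × ℝ} {U : Set Cyl} {f P φ ψ : Cyl → ℝ}

theorem _root_.MeasureTheory.MemLp.comp_shift {m : ℝ≥0∞} (hf : MemLp f m (volume.restrict U))
    (hU : ShiftInvariant e U) (t : ℝ) :
    MemLp (fun z => f (shift e t z)) m (volume.restrict U) :=
  hf.comp_measurePreserving (measurePreserving_shift_restrict hU t)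

theorem n2_comp_shift (hU : ShiftInvariant e U) (f : Cyl → ℝ) (t : ℝ) :
    n2 U (fun z => f (shift e t z)) = n2 U f := by
  rw [n2, n2, integral_comp_shift hU t (fun z => f z ^ 2)]

theorem integral_comp_shift_mul (hU : ShiftInvariant e U) (f φ : Cyl → ℝ) (t : ℝ) :
    ∫ z in U, f (shift e t z) * φ z = ∫ z in U, f z * φ (shift e (-t) z) := by
  rw [← integral_comp_shift hU (-t)]
  simp [shift_shift, shift_zero]

/-- In an invariant `U` the translates of `φ` are again test functions, so the weak derivative can
be used at every time. -/
theorem WD.hasDerivAt (h : WD e U f P) (hU : ShiftInvariant e U)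
    (hf : LocallyIntegrable f (volume.restrict U)) (hφ : IsTestIn U φ) (t : ℝ) :
    HasDerivAt (fun t => ∫ z in U, f z * φ (shift e t z))
      (-∫ z in U, P z * φ (shift e t z)) t := by
  convert hasDerivAt_integral_shift e hf hφ t using 1
  rw [← h _ (hφ.comp_shift hU t)]
  simp only [dE_comp_shift]

theorem locallyIntegrable_of_memLp (hf : MemLp f 2 (volume.restrict U)) :
    LocallyIntegrable f (volume.restrict U) := hf.locallyIntegrable (by norm_num)

theorem integral_sub_shift_mul (hU : ShiftInvariant e U) (hf : MemLp f 2 (volume.restrict U))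
    (hφ : MemLp φ 2 (volume.restrict U)) (t : ℝ) :
    ∫ z in U, (f (shift e t z) - f z) * φ z
      = (∫ z in U, f z * φ (shift e (-t) z)) - ∫ z in U, f z * φ (shift e 0 z) := by
  simp only [sub_mul, shift_zero]
  rw [integral_sub (integrable_mul_of_memLp (hf.comp_shift hU t) hφ) (integrable_mul_of_memLp hf hφ),
    integral_comp_shift_mul hU]

/-- By duality this is the mean value inequality for `t ↦ ∫ f φ(shift e t ·)`, whose derivative is
at most `‖P‖ ‖φ‖` because translations preserve the norm. -/
theorem WD.n2_shift_sub_le (h : WD e U f P) (hU : ShiftInvariant e U) (hUo : IsOpen U)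
    (hf : MemLp f 2 (volume.restrict U)) (hP : MemLp P 2 (volume.restrict U)) (t : ℝ) :
    n2 U (fun z => f (shift e t z) - f z) ≤ |t| * n2 U P := by
  refine n2_le_of_test hUo (memLp_sub (hf.comp_shift hU t) hf)
    (mul_nonneg (abs_nonneg _) (n2_nonneg _ _)) fun φ hφ => ?_
  rw [integral_sub_shift_mul hU hf (hφ.memLp 2)]
  have := Convex.norm_image_sub_le_of_norm_hasDerivWithin_le (s := univ)
    (C := n2 U P * n2 U φ) (x := 0) (y := -t)
    (fun s _ => (h.hasDerivAt hU (locallyIntegrable_of_memLp hf) hφ s).hasDerivWithinAt)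
    (fun s _ => ?_) convex_univ trivial trivial
  · simp only [sub_zero, norm_neg, Real.norm_eq_abs] at this
    linarith
  · rw [norm_neg, Real.norm_eq_abs, ← n2_comp_shift hU φ s]
    exact abs_integral_mul_le hP ((hφ.memLp 2).comp_shift hU s)

/-- A translation of `f` by `t` passes to `φ` as a translation by `-t`, which accounts for the sign
of `D`. -/
theorem tendsto_slope_shift (hU : ShiftInvariant e U) {D : ℝ}
    (hf : MemLp f 2 (volume.restrict U)) (hφ : IsTestIn U φ)
    (hD : HasDerivAt (fun t => ∫ z in U, f z * φ (shift e t z)) (-D) 0) :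
    Tendsto (fun t => t⁻¹ * ∫ z in U, (f (shift e t z) - f z) * φ z) (𝓝[≠] 0) (𝓝 D) := by
  have hD' : HasDerivAt (fun t => ∫ z in U, f z * φ (shift e (-t) z)) D 0 := by
    have h0 : HasDerivAt (fun t => ∫ z in U, f z * φ (shift e t z)) (-D) (-0) := by simpa using hD
    have := h0.comp (h := fun t : ℝ => -t) 0 (hasDerivAt_neg 0)
    simpa [Function.comp_def] using this
  have h1 := hasDerivAt_iff_tendsto_slope_zero.1 hD'
  refine h1.congr fun t => ?_
  rw [integral_sub_shift_mul hU hf (hφ.memLp 2)]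
  simp

theorem WD.tendsto_test (h : WD e U f P) (hU : ShiftInvariant e U)
    (hf : MemLp f 2 (volume.restrict U)) (hφ : IsTestIn U φ) :
    Tendsto (fun t => t⁻¹ * ∫ z in U, (f (shift e t z) - f z) * φ z) (𝓝[≠] 0)
      (𝓝 (∫ z in U, P z * φ z)) := by
  refine tendsto_slope_shift hU hf hφ ?_
  simpa [shift_zero] using h.hasDerivAt hU (locallyIntegrable_of_memLp hf) hφ 0

/-- Convergence against test functions extends to all of `L²` by density, the quotients being
bounded by `‖P‖`. -/
theorem WD.tendsto_slope (h : WD e U f P) (hU : ShiftInvariant e U) (hUo : IsOpen U)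
    (hf : MemLp f 2 (volume.restrict U)) (hP : MemLp P 2 (volume.restrict U))
    (hψ : MemLp ψ 2 (volume.restrict U)) :
    Tendsto (fun t => t⁻¹ * ∫ z in U, (f (shift e t z) - f z) * ψ z) (𝓝[≠] 0)
      (𝓝 (∫ z in U, P z * ψ z)) := by
  rw [Metric.tendsto_nhds]
  intro ε hε
  have hN := n2_nonneg U P
  obtain ⟨φ, hφ, hn⟩ := exists_test_n2_sub_lt hUo hψ
    (show 0 < ε / (2 * (n2 U P + 1)) / 2 by positivity)
  have hφ2 := hφ.memLp (V := U) 2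
  have hb : n2 U P * n2 U (fun z => ψ z - φ z) ≤ ε / 4 := by
    calc _ ≤ (n2 U P + 1) * (ε / (2 * (n2 U P + 1)) / 2) := by
          exact mul_le_mul (by linarith) hn.le (n2_nonneg _ _) (by linarith)
      _ = ε / 4 := by field_simp; norm_num
  filter_upwards [Metric.tendsto_nhds.1 (h.tendsto_test hU hf hφ) (ε / 2) (by positivity),
    self_mem_nhdsWithin] with t ht ht0
  rw [Real.dist_eq] at ht ⊢
  have hd := memLp_sub (hf.comp_shift hU t) hf
  have e1 : ∫ z in U, (f (shift e t z) - f z) * ψ z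
      = (∫ z in U, (f (shift e t z) - f z) * φ z)
        + ∫ z in U, (f (shift e t z) - f z) * (ψ z - φ z) := by
    rw [← integral_add (integrable_mul_of_memLp hd hφ2) (integrable_mul_of_memLp hd (memLp_sub hψ hφ2))]
    congr 1; funext z; ring
  have e2 : ∫ z in U, P z * ψ z = (∫ z in U, P z * φ z) + ∫ z in U, P z * (ψ z - φ z) := by
    rw [← integral_add (integrable_mul_of_memLp hP hφ2) (integrable_mul_of_memLp hP (memLp_sub hψ hφ2))]
    congr 1; funext z; ring
  have b1 : |t⁻¹ * ∫ z in U, (f (shift e t z) - f z) * (ψ z - φ z)| ≤ ε / 4 := by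
    refine le_trans ?_ hb
    rw [abs_mul, abs_inv, inv_mul_le_iff₀ (abs_pos.2 ht0)]
    refine (abs_integral_mul_le hd (hψ.sub hφ2)).trans ?_
    rw [← mul_assoc]
    exact mul_le_mul_of_nonneg_right (h.n2_shift_sub_le hU hUo hf hP t) (n2_nonneg _ _)
  have b2 : |∫ z in U, P z * (ψ z - φ z)| ≤ ε / 4 :=
    (abs_integral_mul_le hP (hψ.sub hφ2)).trans hb
  rw [e1, e2, mul_add]
  rw [abs_lt] at ht ⊢
  rw [abs_le] at b1 b2
  constructor <;> linarith [b1.1, b1.2, b2.1, b2.2, ht.1, ht.2]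

/-- The chain rule for the square of an `L²` function with weak derivative in `L²`. -/
theorem WD.sq (h : WD e U f P) (hU : ShiftInvariant e U) (hUo : IsOpen U)
    (hf : MemLp f 2 (volume.restrict U)) (hP : MemLp P 2 (volume.restrict U)) :
    WD e U (fun z => f z ^ 2) (fun z => 2 * f z * P z) := by
  intro φ hφ
  obtain ⟨C, hC0, hC⟩ := hφ.exists_bound
  have hφm : AEStronglyMeasurable φ (volume.restrict U) := hφ.continuous.aestronglyMeasurable
  have hbd : ∀ {g : Cyl → ℝ}, MemLp g 2 (volume.restrict U) →
      MemLp (fun z => φ z * g z) 2 (volume.restrict U) := fun hg =>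
    MemLp.of_le_mul (c := C) hg (hφm.mul hg.aestronglyMeasurable)
      (Eventually.of_forall fun z => by
        rw [norm_mul]; exact mul_le_mul_of_nonneg_right (hC z) (norm_nonneg _))
  -- The same limit is computed twice; here the translation is moved onto `φ`.
  have hL : Tendsto (fun t => t⁻¹ * ∫ z in U, (f (shift e t z) ^ 2 - f z ^ 2) * φ z) (𝓝[≠] 0)
      (𝓝 (-∫ z in U, f z ^ 2 * dE e φ z)) := by
    have hi : LocallyIntegrable (fun z => f z ^ 2) (volume.restrict U) :=
      hf.integrable_sq.locallyIntegrable
    have hD := hasDerivAt_integral_shift e hi hφ 0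
    have h0 : HasDerivAt (fun t => ∫ z in U, f z ^ 2 * φ (shift e t z))
        (∫ z in U, f z ^ 2 * dE e φ z) (-0) := by simpa [shift_zero] using hD
    have h1 := h0.comp (h := fun t : ℝ => -t) 0 (hasDerivAt_neg 0)
    rw [hasDerivAt_iff_tendsto_slope_zero] at h1
    simp only [mul_neg, mul_one] at h1
    refine h1.congr fun t => ?_
    have hi' : ∀ s, Integrable (fun z => f (shift e s z) ^ 2 * φ z) (volume.restrict U) := fun s =>
      (hf.comp_shift hU s).integrable_mul (hbd (hf.comp_shift hU s)) |>.congr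
        (Eventually.of_forall fun z => by simp; ring)
    have hi0 : Integrable (fun z => f z ^ 2 * φ z) (volume.restrict U) := by
      simpa [shift_zero] using hi' 0
    simp only [sub_mul, Function.comp_def, smul_eq_mul, zero_add, neg_zero, shift_zero]
    rw [integral_sub (hi' t) hi0, integral_comp_shift_mul hU (fun z => f z ^ 2)]
  -- With `d` the increment of `f`, the increment of `f²` is `d (2 f) + d²`. The linear part
  -- converges weakly and the quadratic part is `O(t²)`.
  have hR : Tendsto (fun t => t⁻¹ * ∫ z in U, (f (shift e t z) ^ 2 - f z ^ 2) * φ z) (𝓝[≠] 0)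
      (𝓝 (∫ z in U, 2 * f z * P z * φ z)) := by
    have h1 := h.tendsto_slope hU hUo hf hP (hbd (hf.const_mul 2))
    have h2 : Tendsto (fun t => t⁻¹ * ∫ z in U, (f (shift e t z) - f z)
        * (φ z * (f (shift e t z) - f z))) (𝓝[≠] 0) (𝓝 0) := by
      have hb : Tendsto (fun t : ℝ => |t| * (C * n2 U P ^ 2)) (𝓝[≠] 0) (𝓝 0) := by
        have : Tendsto (fun t : ℝ => |t| * (C * n2 U P ^ 2)) (𝓝 0) (𝓝 (|0| * (C * n2 U P ^ 2))) :=
          (continuous_abs.mul continuous_const).tendsto 0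
        simp only [abs_zero, zero_mul] at this
        exact this.mono_left nhdsWithin_le_nhds
      refine squeeze_zero_norm' ?_ hb
      filter_upwards [self_mem_nhdsWithin] with t ht0
      have hd := memLp_sub (hf.comp_shift hU t) hf
      have hn := h.n2_shift_sub_le hU hUo hf hP t
      have hc : n2 U (fun z => φ z * (f (shift e t z) - f z))
          ≤ C * n2 U (fun z => f (shift e t z) - f z) := by
        rw [← abs_of_nonneg hC0, ← n2_const_mul]
        refine Real.sqrt_le_sqrt (integral_mono (hbd hd).integrable_sq
          (hd.const_mul C).integrable_sq fun z => ?_)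
        simp only [mul_pow]
        refine mul_le_mul_of_nonneg_right (sq_le_sq.2 ?_) (sq_nonneg _)
        rw [abs_of_nonneg hC0]; exact hC z
      rw [norm_mul, norm_inv, Real.norm_eq_abs, Real.norm_eq_abs,
        inv_mul_le_iff₀ (abs_pos.2 ht0)]
      refine (abs_integral_mul_le hd (hbd hd)).trans ?_
      calc _ ≤ (|t| * n2 U P) * (C * (|t| * n2 U P)) :=
            mul_le_mul hn (hc.trans (mul_le_mul_of_nonneg_left hn hC0)) (n2_nonneg _ _)
              (mul_nonneg (abs_nonneg _) (n2_nonneg _ _))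
        _ = _ := by ring
    have h3 := h1.add h2
    rw [add_zero] at h3
    have e3 : ∫ z in U, 2 * f z * P z * φ z = ∫ z in U, P z * (φ z * (2 * f z)) := by
      congr 1; funext z; ring
    rw [e3]
    refine h3.congr fun t => ?_
    have hd := memLp_sub (hf.comp_shift hU t) hf
    rw [← mul_add, ← integral_add (integrable_mul_of_memLp hd (hbd (hf.const_mul 2)))
      (integrable_mul_of_memLp hd (hbd hd))]
    congr 2; funext z; ring
  linarith [tendsto_nhds_unique hL hR]

/-- A function whose difference quotients are bounded in `L²` has a weak derivative in `L²`. -/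
theorem exists_WD_of_n2_shift_sub_le (hU : ShiftInvariant e U)
    (hf : MemLp f 2 (volume.restrict U)) {C : ℝ}
    (h : ∀ t, n2 U (fun z => f (shift e t z) - f z) ≤ |t| * C) :
    ∃ P, MemLp P 2 (volume.restrict U) ∧ WD e U f P := by
  have hm : ∀ t : ℝ, MemLp (fun z => t⁻¹ * (f (shift e t z) - f z)) 2 (volume.restrict U) :=
    fun t => ((hf.comp_shift hU t).sub hf).const_mul _
  let s : ℕ → ℝ := fun n => 1 / ((n : ℝ) + 1)
  have hs0 : ∀ n, 0 < s n := fun n => by positivity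
  have hs : Tendsto s (hyperfilter ℕ : Filter ℕ) (𝓝[≠] 0) := by
    refine tendsto_nhdsWithin_iff.2 ⟨?_, Eventually.of_forall fun n => (hs0 n).ne'⟩
    refine tendsto_one_div_add_atTop_nhds_zero_nat.mono_left ?_
    rw [← Nat.cofinite_eq_atTop]; exact hyperfilter_le_cofinite
  -- The quotients are bounded by `C`. Paired with `φ`, they pass the difference on to `φ`, so their
  -- weak limit is the weak derivative.
  obtain ⟨y, hy⟩ := exists_weak_limit (x := fun n => (hm (s n)).toLp _) (C := C) (fun n => by
    rw [norm_toLp_eq, n2_const_mul, abs_inv, inv_mul_le_iff₀ (abs_pos.2 (hs0 n).ne')]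
    exact h (s n))
  refine ⟨y, Lp.memLp y, fun φ hφ => ?_⟩
  have hφ2 := hφ.memLp (V := U) 2
  have h1 := hy (hφ2.toLp φ)
  have h2 := (tendsto_slope_shift (D := -∫ z in U, f z * dE e φ z) hU hf hφ (by
    simpa [shift_zero] using
      hasDerivAt_integral_shift e (locallyIntegrable_of_memLp hf) hφ 0)).comp hs
  have h3 := tendsto_nhds_unique (h1.congr fun n => ?_) h2
  · rw [← Lp.toLp_coeFn y (Lp.memLp y), inner_toLp_eq] at h3
    linarith
  · rw [inner_toLp_eq]
    simp only [mul_assoc, integral_const_mul, Function.comp]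

end

/-! ### Cut-off functions in the radial variable -/

theorem dE_congr {φ ψ : Cyl → ℝ} {z : Cyl} (h : φ =ᶠ[𝓝 z] ψ) (e : ℝ × ℝ) :
    dE e φ z = dE e ψ z := by
  have hc := (continuous_shift_time e z).tendsto 0
  rw [shift_zero] at hc
  have h' : (fun t => φ (shift e t z)) =ᶠ[𝓝 0] fun t => ψ (shift e t z) := hc.eventually h
  exact h'.deriv_eq

theorem dE_congr_Omega {φ ψ : Cyl → ℝ} (h : EqOn φ ψ Omega) (e : ℝ × ℝ) :
    EqOn (dE e φ) (dE e ψ) Omega := fun _ hz =>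
  dE_congr (h.eventuallyEq_of_mem (isOpen_Omega.mem_nhds hz)) e

/-- A smooth function equal to `0` on `(-∞, δ]` and to `1` on `[2δ, ∞)`. -/
def cut (δ r : ℝ) : ℝ := Real.smoothTransition (r / δ - 1)

/-- A smooth function equal to `0` off `(δ, 1 - δ)` and to `1` on `[2δ, 1 - 2δ]`. -/
def cut2 (δ r : ℝ) : ℝ := cut δ r * cut δ (1 - r)

theorem contDiff_cut (δ : ℝ) : ContDiff ℝ ∞ (cut δ) := by
  unfold cut; exact Real.smoothTransition.contDiff.comp (by fun_prop)

theorem contDiff_cut2 (δ : ℝ) : ContDiff ℝ ∞ (cut2 δ) := by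
  unfold cut2; exact (contDiff_cut δ).mul ((contDiff_cut δ).comp (by fun_prop))

theorem differentiable_of_contDiff {ψ : ℝ → ℝ} (h : ContDiff ℝ ∞ ψ) : Differentiable ℝ ψ :=
  h.differentiable (by simp)

theorem cut_nonneg (δ r : ℝ) : 0 ≤ cut δ r := Real.smoothTransition.nonneg _

theorem cut_le_one (δ r : ℝ) : cut δ r ≤ 1 := Real.smoothTransition.le_one _

theorem cut_eq_zero {δ r : ℝ} (hδ : 0 < δ) (hr : r ≤ δ) : cut δ r = 0 :=
  Real.smoothTransition.zero_of_nonpos (by rw [sub_nonpos, div_le_one hδ]; exact hr)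

theorem cut_eq_one {δ r : ℝ} (hδ : 0 < δ) (hr : 2 * δ ≤ r) : cut δ r = 1 :=
  Real.smoothTransition.one_of_one_le (by rw [le_sub_iff_add_le, le_div_iff₀ hδ]; linarith)

theorem deriv_cut_eq (δ r : ℝ) :
    deriv (cut δ) r = deriv Real.smoothTransition (r / δ - 1) * δ⁻¹ := by
  have h1 : HasDerivAt (fun r => r / δ - 1) δ⁻¹ r := by
    simpa using ((hasDerivAt_id r).div_const δ).sub_const 1
  have h2 : HasDerivAt Real.smoothTransition (deriv Real.smoothTransition (r / δ - 1))
      (r / δ - 1) :=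
    ((Real.smoothTransition.contDiff (n := 1)).differentiable (by simp) _).hasDerivAt
  exact (h2.comp r h1).deriv

theorem deriv_cut_eq_zero {δ r : ℝ} (hδ : 0 < δ) (hr : r < δ ∨ 2 * δ < r) :
    deriv (cut δ) r = 0 := by
  rcases hr with hr | hr
  · have : cut δ =ᶠ[𝓝 r] fun _ => 0 := by
      filter_upwards [Iio_mem_nhds hr] with s hs using cut_eq_zero hδ (le_of_lt hs)
    simpa using this.deriv_eq
  · have : cut δ =ᶠ[𝓝 r] fun _ => 1 := by
      filter_upwards [Ioi_mem_nhds hr] with s hs using cut_eq_one hδ (le_of_lt hs)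
    simpa using this.deriv_eq

theorem deriv_cut_nonneg {δ : ℝ} (hδ : 0 < δ) (r : ℝ) : 0 ≤ deriv (cut δ) r := by
  have : Monotone (cut δ) := fun a b hab => by
    refine Real.smoothTransition.monotone ?_
    gcongr
  exact this.deriv_nonneg

/-- The derivative of `cut δ` is at most `C / δ`. -/
theorem exists_deriv_cut_le : ∃ C, 0 ≤ C ∧ ∀ δ > 0, ∀ r, deriv (cut δ) r ≤ C / δ := by
  have hc : Continuous (deriv Real.smoothTransition) :=
    (Real.smoothTransition.contDiff (n := 1)).continuous_deriv (by simp)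
  -- One profile serves all `δ`: its derivative is bounded on `[0, 1]`, and rescaling contributes
  -- the factor `1 / δ`.
  obtain ⟨C, hC⟩ := isCompact_Icc.exists_bound_of_continuousOn (s := Icc (0 : ℝ) 1) hc.continuousOn
  refine ⟨max C 0, le_max_right _ _, fun δ hδ r => ?_⟩
  by_cases h : r < δ ∨ 2 * δ < r
  · rw [deriv_cut_eq_zero hδ h]; positivity
  · push Not at h
    rw [deriv_cut_eq, div_eq_mul_inv (max C 0)]
    refine mul_le_mul_of_nonneg_right ?_ (by positivity)
    refine (le_abs_self _).trans ((hC _ ⟨?_, ?_⟩).trans (le_max_left _ _))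
    · rw [sub_nonneg, one_le_div hδ]; exact h.1
    · rw [sub_le_iff_le_add, div_le_iff₀ hδ]; linarith

theorem tendsto_cut {r : ℝ} (hr : 0 < r) : Tendsto (fun δ => cut δ r) (𝓝[>] 0) (𝓝 1) := by
  refine tendsto_const_nhds.congr' ?_
  filter_upwards [Ioo_mem_nhdsGT (show 0 < r / 2 by positivity)] with δ hδ
  exact (cut_eq_one hδ.1 (by linarith [hδ.2])).symm

theorem cut2_eq_zero {δ r : ℝ} (hδ : 0 < δ) (hr : r ≤ δ ∨ 1 - δ ≤ r) : cut2 δ r = 0 := by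
  rcases hr with hr | hr
  · simp [cut2, cut_eq_zero hδ hr]
  · simp [cut2, cut_eq_zero hδ (show 1 - r ≤ δ by linarith)]

theorem cut2_eq_one {δ r : ℝ} (hδ : 0 < δ) (h1 : 2 * δ ≤ r) (h2 : r ≤ 1 - 2 * δ) :
    cut2 δ r = 1 := by
  simp [cut2, cut_eq_one hδ h1, cut_eq_one hδ (show 2 * δ ≤ 1 - r by linarith)]

theorem cut2_nonneg (δ r : ℝ) : 0 ≤ cut2 δ r := mul_nonneg (cut_nonneg _ _) (cut_nonneg _ _)

theorem cut2_le_one (δ r : ℝ) : cut2 δ r ≤ 1 :=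
  mul_le_one₀ (cut_le_one _ _) (cut_nonneg _ _) (cut_le_one _ _)

/-- The closed cylinder `δ ≤ r ≤ 1 - δ`. -/
theorem isCompact_strip (a b : ℝ) : IsCompact {z : Cyl | a ≤ z.2 ∧ z.2 ≤ b} := by
  have : {z : Cyl | a ≤ z.2 ∧ z.2 ≤ b} = (univ : Set (AddCircle (2 * π))) ×ˢ Icc a b := by
    ext z; simp
  rw [this]
  exact isCompact_univ.prod isCompact_Icc

theorem isTest_of_eq_zero {φ : Cyl → ℝ} (h : IsSmooth φ) {δ : ℝ} (hδ : 0 < δ)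
    (h0 : ∀ z : Cyl, z.2 ≤ δ ∨ 1 - δ ≤ z.2 → φ z = 0) : IsTestIn Omega φ := by
  have hs : tsupport φ ⊆ {z : Cyl | δ ≤ z.2 ∧ z.2 ≤ 1 - δ} := by
    refine closure_minimal (fun z hz => ?_) (isCompact_strip _ _).isClosed
    by_contra hc
    simp only [mem_ofPred_eq, not_and_or, not_le] at hc
    exact hz (h0 z (hc.imp le_of_lt le_of_lt))
  refine ⟨h, (isCompact_strip _ _).of_isClosed_subset (isClosed_tsupport φ) hs, hs.trans ?_⟩
  rintro z ⟨h1, h2⟩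
  exact ⟨by linarith, by linarith⟩

/-- Brings functions that are only smooth up to the boundary within reach of the weak formulations.
-/
theorem isTest_cut2_mul {φ : Cyl → ℝ} (h : IsSmooth φ) {δ : ℝ} (hδ : 0 < δ) :
    IsTestIn Omega (fun z => cut2 δ z.2 * φ z) :=
  isTest_of_eq_zero ((isSmooth_snd (contDiff_cut2 δ)).mul h) hδ fun z hz => by
    simp [cut2_eq_zero hδ hz]

/-- A compact support keeps `r` away from `0` and `1`; with the factor `2`, `cut2 δ` equals `1` on
it. -/
theorem IsTestIn.exists_strip {φ : Cyl → ℝ} (h : IsTestIn Omega φ) :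
    ∃ δ > 0, ∀ z ∈ tsupport φ, 2 * δ ≤ z.2 ∧ z.2 ≤ 1 - 2 * δ := by
  rcases (tsupport φ).eq_empty_or_nonempty with he | hne
  · exact ⟨1, one_pos, by simp [he]⟩
  have hK : IsCompact (tsupport φ) := h.compact
  obtain ⟨a, ha, hmin⟩ := hK.exists_isMinOn hne continuous_snd.continuousOn
  obtain ⟨b, hb, hmax⟩ := hK.exists_isMaxOn hne continuous_snd.continuousOn
  have h1 := (h.support ha).1
  have h2 := (h.support hb).2
  refine ⟨min a.2 (1 - b.2) / 2, by have := lt_min h1 (sub_pos.2 h2); positivity, fun z hz => ?_⟩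
  have h3 : a.2 ≤ z.2 := hmin hz
  have h4 : z.2 ≤ b.2 := hmax hz
  constructor
  · linarith [min_le_left a.2 (1 - b.2)]
  · linarith [min_le_right a.2 (1 - b.2)]

theorem IsTestIn.eq_zero_of_notMem {U : Set Cyl} {φ : Cyl → ℝ} (h : IsTestIn U φ) {z : Cyl}
    (hz : z ∉ U) : φ z = 0 :=
  image_eq_zero_of_notMem_tsupport fun hc => hz (h.support hc)

/-! ### Products with functions of `r` -/

/-- Multiplication of a test function by a function of `r` that is smooth on `(0, ∞)`. -/
theorem IsTestIn.mul_snd {φ : Cyl → ℝ} (h : IsTestIn Omega φ) {ψ : ℝ → ℝ}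
    (hψ : ContDiffOn ℝ ∞ ψ (Ioi 0)) : IsTestIn Omega (fun z => ψ z.2 * φ z) := by
  refine ⟨?_, h.compact.mul_left, (tsupport_mul_subset_right).trans h.support⟩
  rw [isSmooth_iff, contDiff_iff_contDiffAt]
  intro x
  -- `ψ` may be singular at `r = 0`, but off the support of `φ` the product is locally zero.
  by_cases hx : cover x ∈ tsupport φ
  · have hx2 : 0 < x.2 := (h.support hx).1
    have h1 : ContDiffAt ℝ ∞ ψ x.2 := hψ.contDiffAt (Ioi_mem_nhds hx2)
    exact (h1.comp x contDiffAt_snd).mul (isSmooth_iff.1 h.smooth).contDiffAt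
  · have h0 := (notMem_tsupport_iff_eventuallyEq.1 hx)
    have h1 := continuous_cover.continuousAt.eventually h0
    refine (contDiffAt_const (c := (0 : ℝ))).congr_of_eventuallyEq ?_
    filter_upwards [h1] with y hy
    simp [hy]

theorem IsTestIn.dE_mul_snd {φ : Cyl → ℝ} (h : IsTestIn Omega φ) {ψ : ℝ → ℝ}
    (hψ : ContDiffOn ℝ ∞ ψ (Ioi 0)) (e : ℝ × ℝ) (z : Cyl) :
    DegenerateCylinder.dE e (fun z => ψ z.2 * φ z) z
      = e.2 * deriv ψ z.2 * φ z + ψ z.2 * DegenerateCylinder.dE e φ z := by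
  by_cases hz : z ∈ tsupport φ
  · have hz2 : 0 < z.2 := (h.support hz).1
    have h1 : HasDerivAt (fun t : ℝ => z.2 + t * e.2) e.2 0 := by
      simpa using ((hasDerivAt_id (0 : ℝ)).mul_const e.2).const_add z.2
    have h2 : HasDerivAt ψ (deriv ψ z.2) (z.2 + 0 * e.2) := by
      simpa using ((hψ.contDiffAt (Ioi_mem_nhds hz2)).differentiableAt (by simp)).hasDerivAt
    have h3 := (h2.comp (h := fun t : ℝ => z.2 + t * e.2) (0 : ℝ) h1).mul
      (h.smooth.hasDerivAt_zero e z)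
    have := h3.deriv
    simpa [DegenerateCylinder.dE, shift_zero, mul_comm, shift, Pi.mul_def] using! this
  · have h0 := notMem_tsupport_iff_eventuallyEq.1 hz
    rw [eq_zero_of_eventuallyEq h0, image_eq_zero_of_notMem_tsupport hz,
      eq_zero_of_eventuallyEq]
    · simp
    · filter_upwards [h0] with y hy
      simp [hy]

theorem integrable_mul_test {f φ : Cyl → ℝ} (hf : LocallyIntegrableOn f Omega)
    (h : IsTestIn Omega φ) : Integrable (fun z => f z * φ z) (volume.restrict Omega) := by
  obtain ⟨C, hC0, hC⟩ := h.exists_bound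
  have h1 : IntegrableOn f (tsupport φ) := hf.integrableOn_compact_subset h.support h.compact
  have h2 : IntegrableOn (fun z => f z * φ z) (tsupport φ) :=
    h1.mul_bdd h.continuous.aestronglyMeasurable (Eventually.of_forall hC)
  refine (integrableOn_iff_integrable_of_support_subset (fun z hz => ?_)).1 h2 |>.integrableOn
  by_contra hc
  exact hz (by simp [image_eq_zero_of_notMem_tsupport hc])

/-- Testing with `ψ φ` gives the product rule. Smoothness of `ψ` on `(0, ∞)` suffices, so all real
powers of `r` are allowed. -/
theorem WD.mul_snd {e : ℝ × ℝ} {f P : Cyl → ℝ} (h : WD e Omega f P)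
    (hf : LocallyIntegrableOn f Omega) (hP : LocallyIntegrableOn P Omega) {ψ : ℝ → ℝ}
    (hψ : ContDiffOn ℝ ∞ ψ (Ioi 0)) :
    WD e Omega (fun z => ψ z.2 * f z) (fun z => e.2 * deriv ψ z.2 * f z + ψ z.2 * P z) := by
  intro φ hφ
  have hψ' : ContDiffOn ℝ ∞ (deriv ψ) (Ioi 0) := by
    have := hψ.derivWithin (uniqueDiffOn_Ioi 0) (m := ∞) (by simp)
    exact this.congr fun x hx => (derivWithin_of_isOpen isOpen_Ioi hx).symm
  have i1 := integrable_mul_test hf (hφ.mul_snd hψ')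
  have i2 := integrable_mul_test hP (hφ.mul_snd hψ)
  have i3 := integrable_mul_test hf ((hφ.mul_snd hψ).dE e)
  have h1 := h _ (hφ.mul_snd hψ)
  have e1 : ∫ z in Omega, ψ z.2 * f z * dE e φ z
      = (∫ z in Omega, f z * dE e (fun z => ψ z.2 * φ z) z)
        - ∫ z in Omega, e.2 * (f z * (deriv ψ z.2 * φ z)) := by
    rw [← integral_sub i3 (i1.const_mul _)]
    congr 1; funext z; rw [hφ.dE_mul_snd hψ]; ring
  have e2 : ∫ z in Omega, (e.2 * deriv ψ z.2 * f z + ψ z.2 * P z) * φ z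
      = (∫ z in Omega, e.2 * (f z * (deriv ψ z.2 * φ z)))
        + ∫ z in Omega, P z * (ψ z.2 * φ z) := by
    rw [← integral_add (i1.const_mul _) i2]
    congr 1; funext z; ring
  rw [e1, e2, h1]; ring

theorem WD.congr {e : ℝ × ℝ} {f P f' P' : Cyl → ℝ} (h : WD e Omega f P)
    (hf : ∀ z ∈ Omega, f z = f' z) (hP : ∀ z ∈ Omega, P z = P' z) : WD e Omega f' P' := by
  intro φ hφ
  have e1 : ∫ z in Omega, f z * dE e φ z = ∫ z in Omega, f' z * dE e φ z :=
    setIntegral_congr_fun measurableSet_Omega fun z hz => by simp only [hf z hz]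
  have e2 : ∫ z in Omega, P z * φ z = ∫ z in Omega, P' z * φ z :=
    setIntegral_congr_fun measurableSet_Omega fun z hz => by simp only [hP z hz]
  rw [← e1, ← e2]
  exact h φ hφ

theorem WD.add {e : ℝ × ℝ} {f P f' P' : Cyl → ℝ} (h : WD e Omega f P)
    (h' : WD e Omega f' P')
    (hf : LocallyIntegrableOn f Omega) (hP : LocallyIntegrableOn P Omega)
    (hf' : LocallyIntegrableOn f' Omega) (hP' : LocallyIntegrableOn P' Omega) :
    WD e Omega (fun z => f z + f' z) (fun z => P z + P' z) := by
  intro φ hφ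
  simp only [add_mul]
  rw [integral_add (integrable_mul_test hf (hφ.dE e)) (integrable_mul_test hf' (hφ.dE e)),
    integral_add (integrable_mul_test hP hφ) (integrable_mul_test hP' hφ), h φ hφ, h' φ hφ]
  ring

theorem WD.const_mul {e : ℝ × ℝ} {U : Set Cyl} {f P : Cyl → ℝ} (h : WD e U f P) (c : ℝ) :
    WD e U (fun z => c * f z) (fun z => c * P z) := by
  intro φ hφ
  simp only [mul_assoc, integral_const_mul]
  rw [h φ hφ]; ring

theorem WD.comp_shift {e e' : ℝ × ℝ} {U : Set Cyl} {f P : Cyl → ℝ} (h : WD e U f P)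
    (hU : ShiftInvariant e' U) (t : ℝ) :
    WD e U (fun z => f (shift e' t z)) (fun z => P (shift e' t z)) := by
  intro φ hφ
  rw [integral_comp_shift_mul hU, integral_comp_shift_mul hU, ← h _ (hφ.comp_shift hU (-t))]
  simp only [dE_comp_shift]

/-- Weak derivatives are unique. -/
theorem WD.unique {e : ℝ × ℝ} {f P P' : Cyl → ℝ} (h : WD e Omega f P) (h' : WD e Omega f P')
    (hP : LocallyIntegrableOn P Omega) (hP' : LocallyIntegrableOn P' Omega) :
    P =ᵐ[volume.restrict Omega] P' := by
  have := ae_eq_zero_of_integral_test isOpen_Omega (hP.sub hP') (fun φ hφ => by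
    simp only [Pi.sub_apply, sub_mul]
    rw [integral_sub (integrable_mul_test hP hφ) (integrable_mul_test hP' hφ)]
    linarith [h φ hφ, h' φ hφ])
  filter_upwards [this] with z hz
  simpa [sub_eq_zero] using hz

/-! ### Integrability with power weights -/

theorem volume_slice (a : ℝ) : volume {z : Cyl | z.2 = a} = 0 := by
  have : {z : Cyl | z.2 = a} = (univ : Set (AddCircle (2 * π))) ×ˢ {a} := by
    ext z; simp
  rw [this, Measure.volume_eq_prod, Measure.prod_prod]
  simp

/-- The boundary circles are null, so integrability on `Ω` gives the local integrability up to them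
that the traces require. -/
theorem closedStrip_ae_eq : ({z : Cyl | 0 ≤ z.2 ∧ z.2 ≤ 1} : Set Cyl) =ᵐ[volume] Omega := by
  have h0 : ∀ᵐ z : Cyl, z.2 ≠ 0 := by
    rw [ae_iff]; simpa using volume_slice 0
  have h1 : ∀ᵐ z : Cyl, z.2 ≠ 1 := by
    rw [ae_iff]; simpa using volume_slice 1
  filter_upwards [h0, h1] with z hz0 hz1
  refine propext ⟨fun h => ⟨lt_of_le_of_ne h.1 hz0.symm, lt_of_le_of_ne h.2 hz1⟩,
    fun h => ⟨h.1.le, h.2.le⟩⟩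

theorem locallyIntegrableOn_of_integrable {f : Cyl → ℝ} (hf : Integrable f (volume.restrict Omega))
    {s : Set Cyl} (hs : s ⊆ {z : Cyl | 0 ≤ z.2 ∧ z.2 ≤ 1}) : LocallyIntegrableOn f s := by
  have h : IntegrableOn f {z : Cyl | 0 ≤ z.2 ∧ z.2 ≤ 1} :=
    (integrableOn_congr_set_ae closedStrip_ae_eq).2 hf
  exact (h.mono_set hs).locallyIntegrableOn

theorem Omega_subset_closedStrip : Omega ⊆ {z : Cyl | 0 ≤ z.2 ∧ z.2 ≤ 1} :=
  fun _ hz => ⟨hz.1.le, hz.2.le⟩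

theorem locallyIntegrableOn_of_indicator {f : Cyl → ℝ}
    (hf : ∀ a > 0, Integrable (fun z => (Ioi a).indicator (fun _ => (1 : ℝ)) z.2 * f z)
      (volume.restrict Omega)) : LocallyIntegrableOn f {z : Cyl | 0 < z.2 ∧ z.2 ≤ 1} := by
  intro x hx
  have hx0 : 0 < x.2 := hx.1
  refine ⟨{z : Cyl | x.2 / 2 < z.2} ∩ {z : Cyl | 0 < z.2 ∧ z.2 ≤ 1}, ?_, ?_⟩
  · exact inter_mem (mem_nhdsWithin_of_mem_nhds
      ((isOpen_lt continuous_const continuous_snd).mem_nhds (by simp; linarith)))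
      self_mem_nhdsWithin
  · have h1 : IntegrableOn (fun z => (Ioi (x.2 / 2)).indicator (fun _ => (1 : ℝ)) z.2 * f z)
        {z : Cyl | 0 ≤ z.2 ∧ z.2 ≤ 1} :=
      (integrableOn_congr_set_ae closedStrip_ae_eq).2 (hf _ (by positivity))
    have hm : MeasurableSet ({z : Cyl | x.2 / 2 < z.2} ∩ {z : Cyl | 0 < z.2 ∧ z.2 ≤ 1}) := by
      refine MeasurableSet.inter (measurableSet_lt measurable_const measurable_snd)
        (MeasurableSet.inter (measurableSet_lt measurable_const measurable_snd)
          (measurableSet_le measurable_snd measurable_const))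
    refine (h1.mono_set (t := {z : Cyl | 0 ≤ z.2 ∧ z.2 ≤ 1})
      (s := {z : Cyl | x.2 / 2 < z.2} ∩ {z : Cyl | 0 < z.2 ∧ z.2 ≤ 1})
      fun z hz => ⟨hz.2.1.le, hz.2.2⟩).congr_fun (fun z hz => ?_) hm
    have : z.2 ∈ Ioi (x.2 / 2) := hz.1
    simp [indicator_of_mem this]

theorem memLp_weight {m : ℝ≥0∞} {g : Cyl → ℝ} (hg : MemLp g m (volume.restrict Omega))
    {w : ℝ → ℝ} (hw : Measurable w) {C : ℝ} (hC : ∀ r ∈ Ioo (0 : ℝ) 1, |w r| ≤ C) :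
    MemLp (fun z => w z.2 * g z) m (volume.restrict Omega) := by
  refine MemLp.of_le_mul (c := C) hg
    ((hw.comp measurable_snd).aestronglyMeasurable.mul hg.aestronglyMeasurable) ?_
  rw [ae_restrict_iff' measurableSet_Omega]
  refine Eventually.of_forall fun z hz => ?_
  rw [norm_mul]
  exact mul_le_mul_of_nonneg_right (hC _ hz) (norm_nonneg _)

theorem memLp_congr_Omega {m : ℝ≥0∞} {f g : Cyl → ℝ} (hf : MemLp f m (volume.restrict Omega))
    (h : ∀ z ∈ Omega, f z = g z) : MemLp g m (volume.restrict Omega) :=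
  hf.ae_eq ((ae_restrict_iff' measurableSet_Omega).2 (Eventually.of_forall h))

theorem integrable_congr_Omega {f g : Cyl → ℝ} (hf : Integrable f (volume.restrict Omega))
    (h : ∀ z ∈ Omega, f z = g z) : Integrable g (volume.restrict Omega) :=
  hf.congr ((ae_restrict_iff' measurableSet_Omega).2 (Eventually.of_forall h))

theorem measurable_rpow_const' (a : ℝ) : Measurable (fun r : ℝ => r ^ a) :=
  measurable_id.pow_const a

/-- Since `0 < r < 1`, a larger exponent means a smaller weight. -/
theorem memLp_rpow_mono {m : ℝ≥0∞} {f : Cyl → ℝ} {a b : ℝ}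
    (hf : MemLp (fun z => z.2 ^ a * f z) m (volume.restrict Omega)) (hab : a ≤ b) :
    MemLp (fun z => z.2 ^ b * f z) m (volume.restrict Omega) := by
  refine memLp_congr_Omega (memLp_weight (C := 1) hf (measurable_rpow_const' (b - a))
    fun r hr => ?_) fun z hz => ?_
  · rw [abs_of_nonneg (rpow_nonneg hr.1.le _)]
    exact rpow_le_one hr.1.le hr.2.le (by linarith)
  · have : 0 < z.2 := hz.1
    rw [← mul_assoc, ← rpow_add this]
    simp

theorem memLp_zero_rpow {m : ℝ≥0∞} {f : Cyl → ℝ} (hf : MemLp f m (volume.restrict Omega)) :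
    MemLp (fun z => z.2 ^ (0 : ℝ) * f z) m (volume.restrict Omega) := by
  simpa using hf

theorem integrable_rpow_mul {f g : Cyl → ℝ} {a b c : ℝ}
    (hf : MemLp (fun z => z.2 ^ a * f z) 2 (volume.restrict Omega))
    (hg : MemLp (fun z => z.2 ^ b * g z) 2 (volume.restrict Omega)) (h : a + b ≤ c) :
    Integrable (fun z => z.2 ^ c * (f z * g z)) (volume.restrict Omega) := by
  have h1 := integrable_mul_of_memLp hf (memLp_rpow_mono hg (show b ≤ c - a by linarith))
  refine integrable_congr_Omega h1 fun z hz => ?_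
  have : 0 < z.2 := hz.1
  calc _ = (z.2 ^ a * z.2 ^ (c - a)) * (f z * g z) := by ring
    _ = _ := by rw [← rpow_add this]; simp

theorem memLp_indicator_mul {m : ℝ≥0∞} {f : Cyl → ℝ} {β a : ℝ}
    (hf : MemLp (fun z => z.2 ^ β * f z) m (volume.restrict Omega)) (ha : 0 < a) :
    MemLp (fun z => (Ioi a).indicator (fun _ => (1 : ℝ)) z.2 * f z) m
      (volume.restrict Omega) := by
  refine memLp_congr_Omega (memLp_weight (C := max 1 (a ^ (-β)))
    (w := fun r => (Ioi a).indicator (fun _ => (1 : ℝ)) r * r ^ (-β)) hf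
    ((measurable_const.indicator measurableSet_Ioi).mul (measurable_rpow_const' _))
    fun r hr => ?_) fun z hz => ?_
  · by_cases h : r ∈ Ioi a
    · rw [indicator_of_mem h, one_mul, abs_of_nonneg (rpow_nonneg hr.1.le _)]
      rcases le_total 0 (-β) with hb | hb
      · exact (rpow_le_one hr.1.le hr.2.le hb).trans (le_max_left _ _)
      · exact (rpow_le_rpow_of_nonpos ha (le_of_lt h) hb).trans (le_max_right _ _)
    · rw [indicator_of_notMem h]; simp
  · have : 0 < z.2 := hz.1
    rw [mul_assoc, ← mul_assoc (z.2 ^ (-β)), ← rpow_add this]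
    simp

instance : IsFiniteMeasure ((volume : Measure Cyl).restrict Omega) := by
  refine ⟨?_⟩
  rw [Measure.restrict_apply_univ]
  refine (measure_mono Omega_subset_closedStrip).trans_lt ?_
  exact (isCompact_strip 0 1).measure_lt_top

theorem integrable_of_memLp_two {f : Cyl → ℝ} (hf : MemLp f 2 (volume.restrict Omega)) :
    Integrable f (volume.restrict Omega) := hf.integrable (by norm_num)

/-- Weighted integrability implies local integrability up to `Γ`. -/
theorem locallyIntegrableOn_of_rpow {m : ℝ≥0∞} (hm : 1 ≤ m) {f : Cyl → ℝ} {β : ℝ}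
    (hf : MemLp (fun z => z.2 ^ β * f z) m (volume.restrict Omega)) :
    LocallyIntegrableOn f {z : Cyl | 0 < z.2 ∧ z.2 ≤ 1} :=
  locallyIntegrableOn_of_indicator fun _ ha => (memLp_indicator_mul hf ha).integrable hm

theorem locallyIntegrableOn_Omega_of_rpow {m : ℝ≥0∞} (hm : 1 ≤ m) {f : Cyl → ℝ} {β : ℝ}
    (hf : MemLp (fun z => z.2 ^ β * f z) m (volume.restrict Omega)) :
    LocallyIntegrableOn f Omega :=
  (locallyIntegrableOn_of_rpow hm hf).mono_set fun _ hz => ⟨hz.1, hz.2.le⟩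

theorem deriv_cut2_eq_zero {δ r : ℝ} (hδ : 0 < δ) (hr : r ≤ δ ∨ 1 - δ ≤ r) :
    deriv (cut2 δ) r = 0 := by
  have hmin : IsLocalMin (cut2 δ) r := by
    refine Eventually.of_forall fun s => ?_
    simp only [cut2_eq_zero hδ hr]
    exact cut2_nonneg _ _
  exact hmin.deriv_eq_zero

theorem exists_deriv_cut2_bound (δ : ℝ) : ∃ C, ∀ r ∈ Ioo (0 : ℝ) 1, |deriv (cut2 δ) r| ≤ C := by
  have hc : Continuous (deriv (cut2 δ)) := (contDiff_cut2 δ).continuous_deriv (by simp)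
  obtain ⟨C, hC⟩ := isCompact_Icc.exists_bound_of_continuousOn (s := Icc (0 : ℝ) 1) hc.continuousOn
  exact ⟨C, fun r hr => hC r ⟨hr.1.le, hr.2.le⟩⟩

theorem memLp_volume_of_vanish {m : ℝ≥0∞} {f : Cyl → ℝ} (hf : MemLp f m (volume.restrict Omega))
    (h : ∀ z, z ∉ Omega → f z = 0) : MemLp f m (volume : Measure Cyl) := by
  have : Omega.indicator f = f := by
    refine indicator_eq_self.2 fun z hz => ?_
    by_contra hc
    exact hz (h z hc)
  rw [← this]
  exact (memLp_indicator_iff_restrict measurableSet_Omega).2 hf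

theorem notMem_Omega_imp {z : Cyl} (hz : z ∉ Omega) {δ : ℝ} (hδ : 0 < δ) :
    z.2 ≤ δ ∨ 1 - δ ≤ z.2 := by
  by_contra! hc
  exact hz ⟨by linarith [hc.1], by linarith [hc.2]⟩

/-! ### Chain rule for squares under weights; weak derivatives of smooth functions -/

/-- The chain rule for squares of weakly differentiable functions, under weighted square
integrability. -/
theorem WD.sq_of_rpow {e : ℝ × ℝ} {f P : Cyl → ℝ} {β γ : ℝ} (h : WD e Omega f P)
    (hf : MemLp (fun z => z.2 ^ β * f z) 2 (volume.restrict Omega))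
    (hP : MemLp (fun z => z.2 ^ γ * P z) 2 (volume.restrict Omega)) :
    WD e Omega (fun z => f z ^ 2) (fun z => 2 * f z * P z) := by
  intro φ hφ
  obtain ⟨δ, hδ, hs⟩ := hφ.exists_strip
  have hs' : ∀ z, z ∉ tsupport φ → φ z = 0 ∧ dE e φ z = 0 := fun z hz =>
    ⟨image_eq_zero_of_notMem_tsupport hz,
      image_eq_zero_of_notMem_tsupport fun hc => hz (tsupport_dE_subset φ e hc)⟩
  set δ' := δ / 2 with hδ'
  have hδ0 : 0 < δ' := by positivity
  have hlf := locallyIntegrableOn_Omega_of_rpow (by norm_num) hf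
  have hlP := locallyIntegrableOn_Omega_of_rpow (by norm_num) hP
  -- `Ω` is not invariant in the direction `r`. Hence `f` is cut off near both circles and extended
  -- by zero to the cylinder, where `WD.sq` applies; on the support of `φ` nothing changes.
  let F : Cyl → ℝ := fun z => cut2 δ' z.2 * f z
  let Q : Cyl → ℝ := fun z => e.2 * deriv (cut2 δ') z.2 * f z + cut2 δ' z.2 * P z
  have hWD : WD e Omega F Q := h.mul_snd hlf hlP (contDiff_cut2 δ').contDiffOn
  have hF0 : ∀ z, z ∉ Omega → F z = 0 := fun z hz => by
    simp [F, cut2_eq_zero hδ0 (notMem_Omega_imp hz hδ0)]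
  have hQ0 : ∀ z, z ∉ Omega → Q z = 0 := fun z hz => by
    simp [Q, cut2_eq_zero hδ0 (notMem_Omega_imp hz hδ0),
      deriv_cut2_eq_zero hδ0 (notMem_Omega_imp hz hδ0)]
  have hcutm : Measurable (cut2 δ') := (contDiff_cut2 δ').continuous.measurable
  have hdm : Measurable (deriv (cut2 δ')) := measurable_deriv _
  have hcut : ∀ {g : Cyl → ℝ} {κ : ℝ}, MemLp (fun z => z.2 ^ κ * g z) 2 (volume.restrict Omega) →
      MemLp (fun z => cut2 δ' z.2 * g z) 2 (volume.restrict Omega) := fun {g κ} hg => by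
    refine memLp_congr_Omega (memLp_weight (memLp_indicator_mul hg hδ0) hcutm (C := 1)
      fun r _ => by rw [abs_of_nonneg (cut2_nonneg _ _)]; exact cut2_le_one _ _) fun z hz => ?_
    by_cases hz : z.2 ∈ Ioi δ'
    · simp [indicator_of_mem hz]
    · simp [cut2_eq_zero hδ0 (Or.inl (not_lt.1 hz))]
  obtain ⟨C, hC⟩ := exists_deriv_cut2_bound δ'
  have hdcut : ∀ {g : Cyl → ℝ} {κ : ℝ}, MemLp (fun z => z.2 ^ κ * g z) 2 (volume.restrict Omega) →
      MemLp (fun z => deriv (cut2 δ') z.2 * g z) 2 (volume.restrict Omega) := fun {g κ} hg => by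
    refine memLp_congr_Omega (memLp_weight (memLp_indicator_mul hg hδ0) hdm hC) fun z hz => ?_
    by_cases hz : z.2 ∈ Ioi δ'
    · simp [indicator_of_mem hz]
    · simp [deriv_cut2_eq_zero hδ0 (Or.inl (not_lt.1 hz))]
  have hF : MemLp F 2 (volume.restrict univ) := by
    rw [Measure.restrict_univ]; exact memLp_volume_of_vanish (hcut hf) hF0
  have hQ : MemLp Q 2 (volume.restrict univ) := by
    rw [Measure.restrict_univ]
    refine memLp_volume_of_vanish ?_ hQ0
    refine MemLp.add ?_ (hcut hP)
    simpa only [mul_assoc] using (hdcut hf).const_mul e.2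
  -- A test function on the cylinder need not vanish near the circles. It is multiplied by the wider
  -- cut-off `cut2 η`, which is `1` wherever `F` or `Q` is nonzero.
  have hglob : WD e univ F Q := by
    intro ψ hψ
    set η := δ' / 2 with hη
    have hη0 : 0 < η := by positivity
    have hT := isTest_cut2_mul hψ.smooth hη0
    have hcase : ∀ z : Cyl, (cut2 η z.2 = 1 ∧ dE e (fun z => cut2 η z.2 * ψ z) z = dE e ψ z)
        ∨ (F z = 0 ∧ Q z = 0) := by
      intro z
      by_cases hz : z.2 ≤ δ' ∨ 1 - δ' ≤ z.2
      · exact Or.inr ⟨by simp [F, cut2_eq_zero hδ0 hz],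
          by simp [Q, cut2_eq_zero hδ0 hz, deriv_cut2_eq_zero hδ0 hz]⟩
      · push Not at hz
        refine Or.inl ⟨cut2_eq_one hη0 (by linarith) (by linarith), dE_congr ?_ e⟩
        have hopen : IsOpen {z : Cyl | δ' < z.2 ∧ z.2 < 1 - δ'} :=
          (isOpen_lt continuous_const continuous_snd).inter
            (isOpen_lt continuous_snd continuous_const)
        filter_upwards [hopen.mem_nhds hz] with y hy
        rw [cut2_eq_one hη0 (by linarith [hy.1]) (by linarith [hy.2]), one_mul]
    have h1 := hWD _ hT
    rw [setIntegral_eq_integral_of_forall_compl_eq_zero (fun z hz => by rw [hF0 z hz, zero_mul]),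
      setIntegral_eq_integral_of_forall_compl_eq_zero (fun z hz => by rw [hQ0 z hz, zero_mul])]
      at h1
    rw [Measure.restrict_univ]
    convert h1 using 2
    · funext z
      rcases hcase z with h | h
      · rw [h.2]
      · rw [h.1]; simp
    · congr 1; funext z
      rcases hcase z with h | h
      · rw [h.1, one_mul]
      · rw [h.2]; simp
  have hsq := hglob.sq (shiftInvariant_univ e) isOpen_univ hF hQ φ (hφ.mono (subset_univ _))
  rw [Measure.restrict_univ] at hsq
  rw [setIntegral_eq_integral_of_forall_compl_eq_zero (fun z hz => by
      rw [(hφ.dE e).eq_zero_of_notMem hz, mul_zero]),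
    setIntegral_eq_integral_of_forall_compl_eq_zero (fun z hz => by
      rw [hφ.eq_zero_of_notMem hz, mul_zero])]
  have hone : ∀ z ∈ tsupport φ, F z = f z ∧ Q z = P z := by
    intro z hz
    have hz2 := hs z hz
    have h1 : cut2 δ' z.2 = 1 := cut2_eq_one hδ0 (by linarith) (by linarith)
    have h2 : deriv (cut2 δ') z.2 = 0 := by
      have : cut2 δ' =ᶠ[𝓝 z.2] fun _ => 1 := by
        filter_upwards [Ioo_mem_nhds (show δ < z.2 by linarith)
          (show z.2 < 1 - δ by linarith)] with r hr
        exact cut2_eq_one hδ0 (by linarith [hr.1]) (by linarith [hr.2])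
      simpa using this.deriv_eq
    simp [F, Q, h1, h2]
  convert hsq using 2
  · funext z
    by_cases hz : z ∈ tsupport φ
    · have h1 := (hone z hz).1
      simp only [h1]
    · simp [hs' z hz]
  · congr 1; funext z
    by_cases hz : z ∈ tsupport φ
    · have h1 := (hone z hz).1
      have h2 := (hone z hz).2
      simp only [h1, h2]
    · simp [hs' z hz]

/-- The classical derivative of a smooth function is its weak derivative. -/
theorem IsSmooth.wd {φ : Cyl → ℝ} (h : IsSmooth φ) (e : ℝ × ℝ) :
    WD e Omega φ (DegenerateCylinder.dE e φ) := by
  intro ψ hψ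
  have hT := (hψ.mul_left h).mono (subset_univ Omega)
  have h1 : LocallyIntegrable (fun _ : Cyl => (1 : ℝ)) (volume.restrict univ) := by
    rw [Measure.restrict_univ]
    exact continuous_const.locallyIntegrable
  -- The integral of `φ ψ` is translation invariant, so the integral of its derivative vanishes.
  have h2 := hasDerivAt_integral_shift e h1 hT 0
  have h3 : ∀ t : ℝ, ∫ z in univ, (1 : ℝ) * (φ (shift e t z) * ψ (shift e t z))
      = ∫ z in univ, (1 : ℝ) * (φ z * ψ z) := fun t =>
    integral_comp_shift (shiftInvariant_univ e) t (fun z => 1 * (φ z * ψ z))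
  simp only [h3, shift_zero] at h2
  have h4 := h2.unique (hasDerivAt_const _ _)
  rw [Measure.restrict_univ] at h4
  have h5 : ∫ z in Omega, (φ z * DegenerateCylinder.dE e ψ z
      + DegenerateCylinder.dE e φ z * ψ z) = 0 := by
    rw [setIntegral_eq_integral_of_forall_compl_eq_zero (fun z hz => by
      rw [(hψ.dE e).eq_zero_of_notMem hz, hψ.eq_zero_of_notMem hz]; simp), ← h4]
    congr 1; funext z
    rw [dE_mul h hψ.smooth]; ring
  have hl : ∀ {g : Cyl → ℝ}, IsSmooth g → LocallyIntegrableOn g Omega := fun hg =>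
    hg.continuous.locallyIntegrable.locallyIntegrableOn _
  rw [integral_add (integrable_mul_test (hl h) (hψ.dE e))
    (integrable_mul_test (hl (h.dE e)) hψ)] at h5
  linarith

theorem IsSmooth.exists_bound {φ : Cyl → ℝ} (h : IsSmooth φ) : ∃ C, 0 ≤ C ∧ ∀ z ∈ Omega, |φ z| ≤ C := by
  obtain ⟨C, hC⟩ := (isCompact_strip 0 1).exists_bound_of_continuousOn h.continuous.continuousOn
  exact ⟨max C 0, le_max_right _ _, fun z hz =>
    (hC z (Omega_subset_closedStrip hz)).trans (le_max_left _ _)⟩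

theorem IsSmooth.memLp {φ : Cyl → ℝ} (h : IsSmooth φ) (m : ℝ≥0∞) :
    MemLp φ m (volume.restrict Omega) := by
  obtain ⟨C, _, hC⟩ := h.exists_bound
  exact MemLp.of_bound h.continuous.aestronglyMeasurable C
    ((ae_restrict_iff' measurableSet_Omega).2 (Eventually.of_forall hC))

theorem isWeakGrad_iff {u p q : Cyl → ℝ} : IsWeakGrad u p q ↔
    LocallyIntegrableOn u Omega ∧ LocallyIntegrableOn p Omega ∧ LocallyIntegrableOn q Omega ∧
      WD (1, 0) Omega u p ∧ WD (0, 1) Omega u q := by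
  constructor
  · rintro ⟨h1, h2, h3, h4, h5⟩
    refine ⟨h1, h2, h3, fun φ hφ => ?_, fun φ hφ => ?_⟩
    · rw [← dTheta_eq]; exact h4 φ (isTestIn_Omega.1 hφ)
    · rw [← dR_eq]; exact h5 φ (isTestIn_Omega.1 hφ)
  · rintro ⟨h1, h2, h3, h4, h5⟩
    refine ⟨h1, h2, h3, fun φ hφ => ?_, fun φ hφ => ?_⟩
    · rw [dTheta_eq]; exact h4 φ (isTestIn_Omega.2 hφ)
    · rw [dR_eq]; exact h5 φ (isTestIn_Omega.2 hφ)

/-! ### Zero traces on `Γ^*` and Hardy's inequality -/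

theorem ae_Omega {Pr : Cyl → Prop} (h : ∀ z ∈ Omega, Pr z) : ∀ᵐ z ∂volume.restrict Omega, Pr z :=
  (ae_restrict_iff' measurableSet_Omega).2 (Eventually.of_forall h)

theorem integrable_bdd_mul_Omega {f g : Cyl → ℝ} (hf : Integrable f (volume.restrict Omega))
    (hg : IsSmooth g) : Integrable (fun z => f z * g z) (volume.restrict Omega) := by
  obtain ⟨C, _, hC⟩ := hg.exists_bound
  exact hf.mul_bdd hg.continuous.aestronglyMeasurable (ae_Omega hC)

/-- The derivative is supported in `δ ≤ r ≤ 2δ`, where the factor `r` compensates its size `C / δ`.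
-/
theorem mul_deriv_cut_le {C : ℝ} (hC0 : 0 ≤ C) (hC : ∀ δ > 0, ∀ r, deriv (cut δ) r ≤ C / δ) {δ r : ℝ}
    (hδ : 0 < δ) : r * deriv (cut δ) r ≤ 2 * C := by
  by_cases h : 2 * δ < r
  · rw [deriv_cut_eq_zero hδ (Or.inr h)]; simp; exact hC0
  · calc r * deriv (cut δ) r ≤ (2 * δ) * (C / δ) :=
        mul_le_mul (not_lt.1 h) (hC δ hδ r) (deriv_cut_nonneg hδ r) (by positivity)
      _ = 2 * C := by field_simp

/-- A function `r F` in `W^{1,1}(Ω)` with `F ∈ L^1(Ω)` has zero trace on `Γ^*`. -/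
theorem vanishesOnGammaStar_mul {F P Q : Cyl → ℝ} (hF : Integrable F (volume.restrict Omega))
    (hgrad : IsWeakGrad (fun z => z.2 * F z) P Q) (hP : Integrable P (volume.restrict Omega))
    (hQ : Integrable Q (volume.restrict Omega)) : VanishesOnGammaStar (fun z => z.2 * F z) := by
  have hf : Integrable (fun z : Cyl => z.2 * F z) (volume.restrict Omega) := by
    rw [← memLp_one_iff_integrable] at hF ⊢
    exact memLp_weight hF measurable_id (C := 1) fun r hr => by
      rw [id, abs_of_pos hr.1]; exact hr.2.le
  have hsub : {z : Cyl | 0 ≤ z.2 ∧ z.2 < 1} ⊆ {z : Cyl | 0 ≤ z.2 ∧ z.2 ≤ 1} :=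
    fun z hz => ⟨hz.1, hz.2.le⟩
  refine ⟨integrable_zero _ _ _, P, Q, hgrad, locallyIntegrableOn_of_integrable hf hsub,
    locallyIntegrableOn_of_integrable hP hsub, locallyIntegrableOn_of_integrable hQ hsub,
    fun φ hφ => ?_⟩
  obtain ⟨hs, δ₀, hδ₀, h0⟩ := hφ
  obtain ⟨C, hC0, hC⟩ := exists_deriv_cut_le
  obtain ⟨B, hB0, hB⟩ := hs.exists_bound
  obtain ⟨-, -, hQl, -, hWD⟩ := isWeakGrad_iff.1 hgrad
  simp only [zero_mul, integral_zero, neg_zero]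
  rw [dR_eq]
  let G : Cyl → ℝ := fun z => z.2 * F z * dE (0, 1) φ z + Q z * φ z
  let H : ℝ → Cyl → ℝ := fun δ z => cut δ z.2 * G z + z.2 * F z * (deriv (cut δ) z.2 * φ z)
  have hG : Integrable G (volume.restrict Omega) :=
    (integrable_bdd_mul_Omega hf (hs.dE _)).add (integrable_bdd_mul_Omega hQ hs)
  -- `φ` already vanishes near `Γ`, so for small `δ` the product `cut δ · φ` agrees on `Ω` with a
  -- test function; `H δ` is its Gauss-Green integrand.
  have hH0 : ∀ᶠ δ in 𝓝[>] (0 : ℝ), ∫ z in Omega, H δ z = 0 := by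
    filter_upwards [Ioo_mem_nhdsGT (show 0 < δ₀ / 2 by positivity)] with δ hδ
    have hδ0 : 0 < δ := hδ.1
    have hT := isTest_cut2_mul hs hδ0
    have hEq : EqOn (fun z : Cyl => cut2 δ z.2 * φ z) (fun z => cut δ z.2 * φ z) Omega := by
      intro z hz
      by_cases h1 : 1 - δ₀ < z.2
      · simp [h0 z hz h1]
      · have h2 : cut δ (1 - z.2) = 1 := cut_eq_one hδ0 (by linarith [hδ.2, not_lt.1 h1])
        simp [cut2, h2]
    have hdEq : ∀ z ∈ Omega, dE (0, 1) (fun z : Cyl => cut2 δ z.2 * φ z) z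
        = deriv (cut δ) z.2 * φ z + cut δ z.2 * dE (0, 1) φ z := by
      intro z hz
      rw [dE_congr_Omega hEq (0, 1) hz, dE_mul (isSmooth_snd (contDiff_cut δ)) hs,
        dE_snd (differentiable_of_contDiff (contDiff_cut δ))]
      simp
    have h1 := hWD _ hT
    have i1 := integrable_bdd_mul_Omega hf (hT.smooth.dE (0, 1))
    have i2 := integrable_bdd_mul_Omega hQ hT.smooth
    have h2 : ∫ z in Omega, (z.2 * F z * dE (0, 1) (fun z : Cyl => cut2 δ z.2 * φ z) z
        + Q z * (cut2 δ z.2 * φ z)) = 0 := by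
      rw [integral_add i1 i2, h1]; ring
    rw [← h2]
    refine setIntegral_congr_fun measurableSet_Omega fun z hz => ?_
    have h3 : cut2 δ z.2 * φ z = cut δ z.2 * φ z := hEq hz
    simp only [H, G, hdEq z hz, h3]
    ring
  have hFm := hF.aestronglyMeasurable
  -- The term with the derivative of the cut-off is dominated by a multiple of `|F|` and is
  -- eventually zero at each point.
  have hlim : Tendsto (fun δ => ∫ z in Omega, H δ z) (𝓝[>] 0) (𝓝 (∫ z in Omega, G z)) := by
    refine tendsto_integral_filter_of_dominated_convergence
      (fun z => |G z| + 2 * C * B * |F z|) ?_ ?_ ?_ ?_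
    · refine Eventually.of_forall fun δ => ?_
      have m1 : AEStronglyMeasurable (fun z : Cyl => cut δ z.2) (volume.restrict Omega) :=
        ((contDiff_cut δ).continuous.comp continuous_snd).aestronglyMeasurable
      have m2 : AEStronglyMeasurable (fun z : Cyl => deriv (cut δ) z.2) (volume.restrict Omega) :=
        ((measurable_deriv _).comp measurable_snd).aestronglyMeasurable
      exact (m1.mul hG.aestronglyMeasurable).add
        (hf.aestronglyMeasurable.mul (m2.mul hs.continuous.aestronglyMeasurable))
    · filter_upwards [self_mem_nhdsWithin] with δ hδ
      refine ae_Omega fun z hz => ?_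
      have hδ0 : 0 < δ := hδ
      refine (norm_add_le _ _).trans (add_le_add ?_ ?_)
      · rw [norm_mul, Real.norm_of_nonneg (cut_nonneg _ _)]
        exact mul_le_of_le_one_left (norm_nonneg _) (cut_le_one _ _)
      · have h1 := mul_deriv_cut_le (r := z.2) hC0 hC hδ0
        have h2 : 0 ≤ z.2 * deriv (cut δ) z.2 := mul_nonneg hz.1.le (deriv_cut_nonneg hδ0 _)
        calc ‖z.2 * F z * (deriv (cut δ) z.2 * φ z)‖
            = (z.2 * deriv (cut δ) z.2) * (|φ z| * |F z|) := by
              rw [show z.2 * F z * (deriv (cut δ) z.2 * φ z)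
                = (z.2 * deriv (cut δ) z.2) * (φ z * F z) by ring, norm_mul,
                Real.norm_of_nonneg h2, norm_mul, Real.norm_eq_abs, Real.norm_eq_abs]
          _ ≤ (2 * C) * (B * |F z|) :=
              mul_le_mul h1 (mul_le_mul_of_nonneg_right (hB z hz) (abs_nonneg _))
                (by positivity) (by positivity)
          _ = 2 * C * B * |F z| := by ring
    · exact hG.abs.add (hF.abs.const_mul _)
    · refine ae_Omega fun z hz => ?_
      refine tendsto_const_nhds.congr' ?_
      filter_upwards [Ioo_mem_nhdsGT (show 0 < z.2 / 2 from half_pos hz.1)] with δ hδ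
      have h1 : 2 * δ < z.2 := by linarith [hδ.2]
      simp [H, cut_eq_one hδ.1 h1.le, deriv_cut_eq_zero hδ.1 (Or.inr h1)]
  exact tendsto_nhds_unique hlim (tendsto_const_nhds.congr' (hH0.mono fun _ h => h.symm))

/-- A Hardy inequality: weighted integrability of `u` near `Γ^*`. -/
theorem hardy {u q : Cyl → ℝ} {β s : ℝ} (hs : 0 < s) (hβ : 2 * β ≤ s + 1)
    (hWD : WD (0, 1) Omega u q) (hu : MemLp u 2 (volume.restrict Omega))
    (hq : MemLp (fun z => z.2 ^ β * q z) 2 (volume.restrict Omega)) :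
    Integrable (fun z => z.2 ^ (s - 1) * u z ^ 2) (volume.restrict Omega) := by
  have hu0 := memLp_zero_rpow hu
  have hsq := hWD.sq_of_rpow hu0 hq
  have hqq : Integrable (fun z => z.2 ^ (s + 1) * (q z * q z)) (volume.restrict Omega) :=
    integrable_rpow_mul hq hq (by linarith)
  have huu : Integrable (fun z => u z ^ 2) (volume.restrict Omega) := hu.integrable_sq
  obtain ⟨C, hC0, hC⟩ := exists_deriv_cut_le
  have hψ : ContDiffOn ℝ ∞ (fun r : ℝ => r ^ s) (Ioi 0) := fun r hr =>
    (contDiffAt_rpow_const_of_ne (ne_of_gt hr)).contDiffWithinAt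
  let κ : ℝ → ℝ := fun r => cut (1 / 4) (1 - r)
  have hκ : ContDiff ℝ ∞ κ := (contDiff_cut _).comp (by fun_prop)
  have hκ0 : ∀ r, 0 ≤ κ r := fun r => cut_nonneg _ _
  have hκ1 : ∀ r, κ r ≤ 1 := fun r => cut_le_one _ _
  have hdκ : ∀ r, deriv κ r = -deriv (cut (1 / 4)) (1 - r) := fun r =>
    deriv_comp_const_sub (f := cut (1 / 4)) 1 r
  -- Test `∂_r (u²)` with `r^s cut δ κ`. The cross term is absorbed by `2 |u q| r^s ≤ (s/2) r^{s-1}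
  -- u² + (2/s) r^{s+1} q²`. The derivative of `cut δ` has the favourable sign, and that of `κ`
  -- costs at most `C / (1/4) = 4C`. The resulting bound `K` does not depend on `δ`.
  let K : ℝ := ∫ z in Omega, (2 / s * (z.2 ^ (s + 1) * (q z * q z)) + 4 * C * u z ^ 2)
  have key : ∀ δ ∈ Ioo (0 : ℝ) (1 / 4), Integrable (fun z : Cyl => z.2 ^ (s - 1) * u z ^ 2
      * (cut δ z.2 * κ z.2)) (volume.restrict Omega) ∧
      s / 2 * ∫ z in Omega, z.2 ^ (s - 1) * u z ^ 2 * (cut δ z.2 * κ z.2) ≤ K := by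
    rintro δ ⟨hδ0, hδ1⟩
    let m : ℝ → ℝ := fun r => cut δ r * κ r
    have hm : ContDiff ℝ ∞ m := (contDiff_cut δ).mul hκ
    have hT : IsTestIn Omega (fun z => m z.2) := by
      refine isTest_of_eq_zero (isSmooth_snd hm) hδ0 fun z hz => ?_
      rcases hz with hz | hz
      · simp [m, cut_eq_zero hδ0 hz]
      · have h1 : κ z.2 = 0 := cut_eq_zero (by norm_num) (by linarith)
        simp [m, h1]
    have hdm : ∀ r, deriv m r = deriv (cut δ) r * κ r - cut δ r * deriv (cut (1 / 4)) (1 - r) := by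
      intro r
      have := ((differentiable_of_contDiff (contDiff_cut δ) r).hasDerivAt.mul
        (differentiable_of_contDiff hκ r).hasDerivAt).deriv
      rw [hdκ] at this
      rw [show m = cut δ * κ from rfl, this]
      ring
    have hT1 := hT.mul_snd hψ
    have hdT : ∀ z ∈ Omega, dE (0, 1) (fun z : Cyl => z.2 ^ s * m z.2) z
        = s * z.2 ^ (s - 1) * m z.2 + z.2 ^ s * deriv m z.2 := by
      intro z hz
      rw [hT.dE_mul_snd hψ, dE_snd (differentiable_of_contDiff hm)]
      rw [show deriv (fun r : ℝ => r ^ s) z.2 = s * z.2 ^ (s - 1) from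
        (Real.hasDerivAt_rpow_const (Or.inl (ne_of_gt hz.1))).deriv]
      simp
    have hψ' : ContDiffOn ℝ ∞ (fun r : ℝ => r ^ (s - 1)) (Ioi 0) := fun r hr =>
      (contDiffAt_rpow_const_of_ne (ne_of_gt hr)).contDiffWithinAt
    have i0 : Integrable (fun z : Cyl => z.2 ^ (s - 1) * u z ^ 2 * m z.2)
        (volume.restrict Omega) := by
      have := integrable_bdd_mul_Omega huu (hT.mul_snd hψ').smooth
      exact this.congr (Eventually.of_forall fun z => by simp only; ring)
    refine ⟨i0, ?_⟩
    have i1 := integrable_bdd_mul_Omega huu (hT1.dE (0, 1)).smooth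
    have h1 := hsq _ hT1
    have i2 : Integrable (fun z => 2 * u z * q z * (z.2 ^ s * m z.2)) (volume.restrict Omega) := by
      refine integrable_mul_test ?_ hT1
      have h3 : Integrable (fun z => z.2 ^ β * (2 * u z * q z)) (volume.restrict Omega) :=
        ((integrable_rpow_mul hu0 hq (c := β) (by linarith)).const_mul 2).congr
          (Eventually.of_forall fun z => by simp only; ring)
      exact locallyIntegrableOn_Omega_of_rpow le_rfl (memLp_one_iff_integrable.2 h3)
    have h2 : ∫ z in Omega, (u z ^ 2 * dE (0, 1) (fun z : Cyl => z.2 ^ s * m z.2) z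
        + 2 * u z * q z * (z.2 ^ s * m z.2)) = 0 := by
      rw [integral_add i1 i2, h1]; ring
    have iK : Integrable (fun z => 2 / s * (z.2 ^ (s + 1) * (q z * q z)) + 4 * C * u z ^ 2)
        (volume.restrict Omega) := (hqq.const_mul _).add (huu.const_mul _)
    have h4 : ∫ z in Omega, (s / 2 * (z.2 ^ (s - 1) * u z ^ 2 * m z.2)
        - (2 / s * (z.2 ^ (s + 1) * (q z * q z)) + 4 * C * u z ^ 2)) ≤ 0 := by
      rw [← h2]
      refine integral_mono_ae ((i0.const_mul _).sub iK) (i1.add i2) (ae_Omega fun z hz => ?_)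
      have hz0 : 0 < z.2 := hz.1
      simp only [hdT z hz, hdm]
      have hm0 : 0 ≤ m z.2 := mul_nonneg (cut_nonneg _ _) (hκ0 _)
      have hm1 : m z.2 ≤ 1 := mul_le_one₀ (cut_le_one _ _) (hκ0 _) (hκ1 _)
      have e1 : z.2 ^ s = z.2 ^ (s - 1) * z.2 := by
        rw [← rpow_add_one hz0.ne']; simp
      have e2 : z.2 ^ (s + 1) = z.2 ^ (s - 1) * z.2 ^ 2 := by
        rw [rpow_add_one hz0.ne', e1]; ring
      have hp : 0 ≤ z.2 ^ (s - 1) := rpow_nonneg hz0.le _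
      have t1 : 0 ≤ z.2 ^ (s - 1) * m z.2 * (s / 2 * (u z + 2 / s * z.2 * q z) ^ 2) := by positivity
      have t2 : 0 ≤ u z ^ 2 * (z.2 ^ s * (deriv (cut δ) z.2 * κ z.2)) :=
        mul_nonneg (sq_nonneg _) (mul_nonneg (rpow_nonneg hz0.le _)
          (mul_nonneg (deriv_cut_nonneg hδ0 _) (hκ0 _)))
      have t3 : z.2 ^ s * (cut δ z.2 * deriv (cut (1 / 4)) (1 - z.2)) ≤ 1 * (1 * (C / (1 / 4))) := by
        have hd0 := deriv_cut_nonneg (show (0 : ℝ) < 1 / 4 by norm_num) (1 - z.2)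
        refine mul_le_mul (rpow_le_one hz0.le hz.2.le hs.le) ?_
          (mul_nonneg (cut_nonneg _ _) hd0) zero_le_one
        exact mul_le_mul (cut_le_one _ _) (hC _ (by norm_num) _) hd0 zero_le_one
      have t4 := mul_le_mul_of_nonneg_left t3 (sq_nonneg (u z))
      have t5 : 2 / s * (z.2 ^ (s + 1) * (q z * q z)) * m z.2
          ≤ 2 / s * (z.2 ^ (s + 1) * (q z * q z)) :=
        mul_le_of_le_one_right (by have := mul_self_nonneg (q z); positivity) hm1
      have t6 : z.2 ^ (s - 1) * m z.2 * (s / 2 * (u z + 2 / s * z.2 * q z) ^ 2)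
          = s / 2 * (z.2 ^ (s - 1) * u z ^ 2 * m z.2) + 2 * u z * q z * (z.2 ^ s * m z.2)
            + 2 / s * (z.2 ^ (s + 1) * (q z * q z)) * m z.2 := by
        rw [e1, e2]; field_simp; ring
      nlinarith [t1, t2, t4, t5, t6]
    rw [integral_sub (i0.const_mul _) iK, integral_const_mul] at h4
    linarith
  have hmeas : AEStronglyMeasurable (fun z => z.2 ^ (s - 1) * u z ^ 2) (volume.restrict Omega) :=
    ((measurable_rpow_const' (s - 1)).comp measurable_snd).aestronglyMeasurable.mul
      huu.aestronglyMeasurable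
  have hnn : ∀ z ∈ Omega, 0 ≤ z.2 ^ (s - 1) * u z ^ 2 := fun z hz =>
    mul_nonneg (rpow_nonneg hz.1.le _) (sq_nonneg _)
  have hκc : Continuous (fun z : Cyl => κ z.2) := hκ.continuous.comp continuous_snd
  have hnear : Integrable (fun z => z.2 ^ (s - 1) * u z ^ 2 * κ z.2) (volume.restrict Omega) := by
    -- The factor `1/8` keeps `a n` below `1/4`. On `2 a n < r` the inner cut-off is `1`, and these
    -- sets exhaust `Ω`.
    let a : ℕ → ℝ := fun n => 1 / ((n : ℝ) + 1) / 8
    have ha0 : ∀ n, 0 < a n := fun n => by positivity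
    have ha1 : ∀ n, a n < 1 / 4 := fun n => by
      have : 1 / ((n : ℝ) + 1) ≤ 1 := by
        rw [div_le_one (by positivity)]; linarith [Nat.cast_nonneg (α := ℝ) n]
      simp only [a]; linarith
    have hat : Tendsto a atTop (𝓝 0) := by
      have := (tendsto_one_div_add_atTop_nhds_zero_nat (𝕜 := ℝ)).div_const 8
      rwa [zero_div] at this
    have hS : ∀ n, MeasurableSet {z : Cyl | 2 * a n < z.2} := fun n =>
      measurableSet_lt measurable_const measurable_snd
    have hcov : AECover (volume.restrict Omega) atTop (fun n => {z : Cyl | 2 * a n < z.2}) := by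
      refine ⟨ae_Omega fun z hz => ?_, hS⟩
      have : Tendsto (fun n => 2 * a n) atTop (𝓝 0) := by simpa using hat.const_mul 2
      exact this.eventually (gt_mem_nhds hz.1)
    have heq : ∀ n, ∀ z ∈ {z : Cyl | 2 * a n < z.2}, z.2 ^ (s - 1) * u z ^ 2
      * (cut (a n) z.2 * κ z.2) = z.2 ^ (s - 1) * u z ^ 2 * κ z.2 := fun n z hz => by
      rw [cut_eq_one (ha0 n) (le_of_lt hz), one_mul]
    refine hcov.integrable_of_integral_bounded_of_nonneg_ae (2 / s * K) (fun n => ?_)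
      (ae_Omega fun z hz => mul_nonneg (hnn z hz) (hκ0 _)) (Eventually.of_forall fun n => ?_)
    · exact (key (a n) ⟨ha0 n, ha1 n⟩).1.integrableOn.congr_fun (heq n) (hS n)
    · rw [← setIntegral_congr_fun (hS n) (heq n)]
      obtain ⟨j1, j2⟩ := key (a n) ⟨ha0 n, ha1 n⟩
      refine (setIntegral_le_integral j1 (ae_Omega fun z hz =>
        mul_nonneg (hnn z hz) (mul_nonneg (cut_nonneg _ _) (hκ0 _)))).trans ?_
      rw [div_mul_eq_mul_div, le_div_iff₀ hs]
      linarith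
  -- `κ` can drop below `1` only for `r > 1/2`, where the weight is harmless and `u ∈ L²` suffices.
  have hfar : Integrable (fun z : Cyl => (Ioi (1 / 2 : ℝ)).indicator (fun _ => (1 : ℝ)) z.2
      * (z.2 ^ (s - 1) * u z ^ 2)) (volume.restrict Omega) := by
    rw [← memLp_one_iff_integrable] at huu ⊢
    refine memLp_indicator_mul (β := -(s - 1)) (memLp_congr_Omega huu fun z hz => ?_) (by norm_num)
    rw [← mul_assoc, ← rpow_add hz.1]; simp
  refine (hnear.add hfar).mono' hmeas (ae_Omega fun z hz => ?_)
  rw [Real.norm_of_nonneg (hnn z hz)]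
  simp only [Pi.add_apply]
  by_cases h : z.2 ∈ Ioi (1 / 2 : ℝ)
  · rw [indicator_of_mem h, one_mul]
    linarith [mul_nonneg (hnn z hz) (hκ0 z.2)]
  · rw [indicator_of_notMem h, show κ z.2 = 1 from cut_eq_one (by norm_num) (by
      have := not_lt.1 (mem_Ioi.not.1 h); linarith)]
    linarith

/-! ### The spaces `H^1(Ω; w)` and `H^1_Γ(Ω; w)` -/

theorem shift_theta_snd (t : ℝ) (z : Cyl) : (shift (1, 0) t z).2 = z.2 := by simp [shift]

theorem locallyIntegrableOn_Omega_of_memLp {f : Cyl → ℝ}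
    (hf : MemLp f 2 (volume.restrict Omega)) : LocallyIntegrableOn f Omega :=
  locallyIntegrableOn_Omega_of_rpow (by norm_num) (memLp_zero_rpow hf)

theorem isH1w_iff {α : ℝ} {u p q : Cyl → ℝ} : IsH1w α u p q ↔
    MemLp u 2 (volume.restrict Omega) ∧ MemLp p 2 (volume.restrict Omega) ∧
      MemLp (fun z => z.2 ^ (α / 2) * q z) 2 (volume.restrict Omega) ∧
      WD (1, 0) Omega u p ∧ WD (0, 1) Omega u q := by
  constructor
  · rintro ⟨h1, h2, h3, h4⟩
    obtain ⟨-, -, -, h5, h6⟩ := isWeakGrad_iff.1 h1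
    exact ⟨h2, h3, h4, h5, h6⟩
  · rintro ⟨h2, h3, h4, h5, h6⟩
    exact ⟨isWeakGrad_iff.2 ⟨locallyIntegrableOn_Omega_of_memLp h2,
      locallyIntegrableOn_Omega_of_memLp h3, locallyIntegrableOn_Omega_of_rpow (by norm_num) h4,
      h5, h6⟩, h2, h3, h4⟩

section

variable {α : ℝ} {u p q u' p' q' : Cyl → ℝ}

theorem IsH1w.add (h : IsH1w α u p q) (h' : IsH1w α u' p' q') :
    IsH1w α (fun z => u z + u' z) (fun z => p z + p' z) (fun z => q z + q' z) := by
  have g := h.grad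
  have g' := h'.grad
  obtain ⟨a1, a2, a3, a4, a5⟩ := isH1w_iff.1 h
  obtain ⟨b1, b2, b3, b4, b5⟩ := isH1w_iff.1 h'
  refine isH1w_iff.2 ⟨a1.add b1, a2.add b2, ?_, a4.add b4 g.locInt g.locInt_theta g'.locInt
    g'.locInt_theta, a5.add b5 g.locInt g.locInt_r g'.locInt g'.locInt_r⟩
  simpa only [mul_add] using! a3.add b3

theorem IsH1w.const_mul (h : IsH1w α u p q) (c : ℝ) :
    IsH1w α (fun z => c * u z) (fun z => c * p z) (fun z => c * q z) := by
  obtain ⟨a1, a2, a3, a4, a5⟩ := isH1w_iff.1 h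
  refine isH1w_iff.2 ⟨a1.const_mul c, a2.const_mul c, ?_, a4.const_mul c, a5.const_mul c⟩
  refine (a3.const_mul c).ae_eq (Eventually.of_forall fun z => ?_)
  simp only; ring

theorem IsH1w.comp_shift (h : IsH1w α u p q) (t : ℝ) :
    IsH1w α (fun z => u (shift (1, 0) t z)) (fun z => p (shift (1, 0) t z))
      (fun z => q (shift (1, 0) t z)) := by
  obtain ⟨a1, a2, a3, a4, a5⟩ := isH1w_iff.1 h
  refine isH1w_iff.2 ⟨a1.comp_shift shiftInvariant_Omega t, a2.comp_shift shiftInvariant_Omega t,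
    ?_, a4.comp_shift shiftInvariant_Omega t, a5.comp_shift shiftInvariant_Omega t⟩
  simpa only [shift_theta_snd] using a3.comp_shift shiftInvariant_Omega t

theorem IsSmooth.isH1w {φ : Cyl → ℝ} (h : IsSmooth φ) (hα : 0 ≤ α) :
    IsH1w α φ (dTheta φ) (dR φ) := by
  rw [dTheta_eq, dR_eq]
  exact isH1w_iff.2 ⟨h.memLp 2, (h.dE _).memLp 2,
    memLp_rpow_mono (memLp_zero_rpow ((h.dE _).memLp 2)) (by positivity), h.wd _, h.wd _⟩

theorem rpow_half_mul_sq {r : ℝ} (hr : 0 < r) (α q : ℝ) : (r ^ (α / 2) * q) ^ 2 = r ^ α * q ^ 2 := by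
  rw [mul_pow, ← rpow_natCast, ← rpow_mul hr.le]
  norm_num

theorem IsH1w.integrable_weighted_sq (h : IsH1w α u p q) :
    Integrable (fun z => z.2 ^ α * q z ^ 2) (volume.restrict Omega) :=
  integrable_congr_Omega h.memLp_r.integrable_sq fun z hz => rpow_half_mul_sq hz.1 α (q z)

theorem IsH1w.integrable_energy (h : IsH1w α u p q) :
    Integrable (fun z => u z ^ 2 + p z ^ 2 + z.2 ^ α * q z ^ 2) (volume.restrict Omega) :=
  (h.memLp.integrable_sq.add h.memLp_theta.integrable_sq).add h.integrable_weighted_sq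

theorem IsH1w.sub_smooth (h : IsH1w α u p q) {φ : Cyl → ℝ} (hφ : IsSmooth φ) (hα : 0 ≤ α) :
    IsH1w α (fun z => u z - φ z) (fun z => p z - dTheta φ z) (fun z => q z - dR φ z) := by
  have := h.add ((hφ.isH1w hα).const_mul (-1))
  simpa only [neg_mul, one_mul, ← sub_eq_add_neg] using this

/-- The functions of `H^1(Ω; w)` with gradient `(p, q)` that are limits of elements of `C_Γ^∞`. -/
def IsH1Gamma (α : ℝ) (u p q : Cyl → ℝ) : Prop :=
  IsH1w α u p q ∧ ∀ η > 0, ∃ φ, IsSmoothGamma φ ∧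
    ∫ z, ((u z - φ z) ^ 2 + (p z - dTheta φ z) ^ 2 + z.2 ^ α * (q z - dR φ z) ^ 2) ∂muOmega < η

theorem IsSmoothGamma.add {φ ψ : Cyl → ℝ} (h : IsSmoothGamma φ) (h' : IsSmoothGamma ψ) :
    IsSmoothGamma (fun z => φ z + ψ z) := by
  obtain ⟨h1, δ, hδ, h2⟩ := h
  obtain ⟨h1', δ', hδ', h2'⟩ := h'
  refine ⟨h1.add h1', min δ δ', lt_min hδ hδ', fun z hz hr => ?_⟩
  rw [h2 z hz (by linarith [min_le_left δ δ']), h2' z hz (by linarith [min_le_right δ δ'])]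
  simp

theorem IsSmoothGamma.const_mul {φ : Cyl → ℝ} (h : IsSmoothGamma φ) (c : ℝ) :
    IsSmoothGamma (fun z => c * φ z) := by
  obtain ⟨h1, δ, hδ, h2⟩ := h
  exact ⟨(isSmooth_const c).mul h1, δ, hδ, fun z hz hr => by rw [h2 z hz hr, mul_zero]⟩

theorem IsSmoothGamma.comp_shift {φ : Cyl → ℝ} (h : IsSmoothGamma φ) (t : ℝ) :
    IsSmoothGamma (fun z => φ (shift (1, 0) t z)) := by
  obtain ⟨h1, δ, hδ, h2⟩ := h
  exact ⟨h1.comp_shift _ t, δ, hδ, fun z hz hr =>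
    h2 _ ((shiftInvariant_Omega t z).2 hz) (by rwa [shift_theta_snd])⟩

/-- Together with `IsH1Gamma.const_mul` and `IsH1Gamma.comp_shift`, this makes the tangential second
difference of `u` an admissible test function. -/
theorem IsH1Gamma.add (h : IsH1Gamma α u p q) (h' : IsH1Gamma α u' p' q') (hα : 0 ≤ α) :
    IsH1Gamma α (fun z => u z + u' z) (fun z => p z + p' z) (fun z => q z + q' z) := by
  refine ⟨h.1.add h'.1, fun η hη => ?_⟩
  obtain ⟨φ, hφ, h1⟩ := h.2 (η / 4) (by positivity)
  obtain ⟨ψ, hψ, h2⟩ := h'.2 (η / 4) (by positivity)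
  refine ⟨_, hφ.add hψ, ?_⟩
  have i1 := (h.1.sub_smooth hφ.smooth hα).integrable_energy.const_mul 2
  have i2 := (h'.1.sub_smooth hψ.smooth hα).integrable_energy.const_mul 2
  have i3 := ((h.1.add h'.1).sub_smooth (hφ.add hψ).smooth hα).integrable_energy
  refine lt_of_le_of_lt (integral_mono_ae i3 (i1.add i2) (ae_Omega fun z hz => ?_)) ?_
  · have hw : 0 ≤ z.2 ^ α := rpow_nonneg hz.1.le _
    simp only [Pi.add_apply]
    rw [dTheta_eq, dR_eq, dE_add hφ.smooth hψ.smooth, dE_add hφ.smooth hψ.smooth, dTheta_eq,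
      dR_eq, dTheta_eq, dR_eq]
    have key : ∀ a b c d : ℝ, (a + b - (c + d)) ^ 2 ≤ 2 * (a - c) ^ 2 + 2 * (b - d) ^ 2 :=
      fun a b c d => by nlinarith [sq_nonneg (a - c - (b - d))]
    have k1 := key (u z) (u' z) (φ z) (ψ z)
    have k2 := key (p z) (p' z) (dE (1, 0) φ z) (dE (1, 0) ψ z)
    have k3 := mul_le_mul_of_nonneg_left (key (q z) (q' z) (dE (0, 1) φ z) (dE (0, 1) ψ z)) hw
    linarith
  · simp only [Pi.add_apply]
    rw [muOmega] at h1 h2 ⊢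
    rw [integral_add i1 i2, integral_const_mul, integral_const_mul]
    linarith

theorem IsH1Gamma.const_mul (h : IsH1Gamma α u p q) (c : ℝ) :
    IsH1Gamma α (fun z => c * u z) (fun z => c * p z) (fun z => c * q z) := by
  refine ⟨h.1.const_mul c, fun η hη => ?_⟩
  obtain ⟨φ, hφ, h1⟩ := h.2 (η / (c ^ 2 + 1)) (by positivity)
  refine ⟨_, hφ.const_mul c, ?_⟩
  rw [lt_div_iff₀ (by positivity)] at h1
  have e : ∀ z, (c * u z - c * φ z) ^ 2 + (c * p z - dTheta (fun z => c * φ z) z) ^ 2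
      + z.2 ^ α * (c * q z - dR (fun z => c * φ z) z) ^ 2
      = c ^ 2 * ((u z - φ z) ^ 2 + (p z - dTheta φ z) ^ 2 + z.2 ^ α * (q z - dR φ z) ^ 2) := by
    intro z
    rw [dTheta_eq, dR_eq, dE_const_mul hφ.smooth, dE_const_mul hφ.smooth, dTheta_eq,
      dR_eq]
    ring
  simp only [e]
  rw [integral_const_mul]
  have h0 : 0 ≤ ∫ z, ((u z - φ z) ^ 2 + (p z - dTheta φ z) ^ 2
      + z.2 ^ α * (q z - dR φ z) ^ 2) ∂muOmega :=
    integral_nonneg_of_ae (ae_Omega fun z hz => by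
      have : 0 ≤ z.2 ^ α := rpow_nonneg hz.1.le _
      simp only [Pi.zero_apply]; positivity)
  nlinarith

theorem IsH1Gamma.comp_shift (h : IsH1Gamma α u p q) (t : ℝ) :
    IsH1Gamma α (fun z => u (shift (1, 0) t z)) (fun z => p (shift (1, 0) t z))
      (fun z => q (shift (1, 0) t z)) := by
  refine ⟨h.1.comp_shift t, fun η hη => ?_⟩
  obtain ⟨φ, hφ, h1⟩ := h.2 η hη
  refine ⟨_, hφ.comp_shift t, ?_⟩
  rw [dTheta_eq, dR_eq, muOmega] at h1 ⊢
  simp only [dE_comp_shift]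
  rw [← integral_comp_shift shiftInvariant_Omega t] at h1
  simpa only [shift_theta_snd] using h1

theorem IsSmoothGamma.isH1Gamma {φ : Cyl → ℝ} (h : IsSmoothGamma φ) (hα : 0 ≤ α) :
    IsH1Gamma α φ (dTheta φ) (dR φ) :=
  ⟨h.smooth.isH1w hα, fun η hη => ⟨φ, h, by simpa using hη⟩⟩

theorem IsTestIn.isSmoothGamma {φ : Cyl → ℝ} (h : IsTestIn Omega φ) : IsSmoothGamma φ := by
  obtain ⟨δ, hδ, hs⟩ := h.exists_strip
  refine ⟨h.smooth, δ, hδ, fun z _ hr => ?_⟩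
  by_contra hc
  have := hs z (subset_tsupport _ hc)
  linarith [this.2]

theorem IsH1Gamma.memH1Gamma (h : IsH1Gamma α u p q) : MemH1Gamma α u := ⟨p, q, h⟩

/-- Elements of `H^1_Γ` with a prescribed weak gradient. -/
theorem MemH1Gamma.isH1Gamma (h : MemH1Gamma α u) (hg : IsWeakGrad u p q) :
    IsH1Gamma α u p q := by
  obtain ⟨p₀, q₀, h1, h2⟩ := h
  obtain ⟨a1, a2, a3, a4, a5⟩ := isWeakGrad_iff.1 hg
  obtain ⟨b1, b2, b3, b4, b5⟩ := isWeakGrad_iff.1 h1.grad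
  have hp : p₀ =ᵐ[volume.restrict Omega] p := b4.unique a4 b2 a2
  have hq : q₀ =ᵐ[volume.restrict Omega] q := b5.unique a5 b3 a3
  refine ⟨⟨hg, h1.memLp, h1.memLp_theta.ae_eq hp, h1.memLp_r.ae_eq ?_⟩, fun η hη => ?_⟩
  · filter_upwards [hq] with z hz
    rw [hz]
  · obtain ⟨φ, hφ, h3⟩ := h2 η hη
    refine ⟨φ, hφ, ?_⟩
    convert h3 using 1
    refine integral_congr_ae ?_
    unfold muOmega
    filter_upwards [hp, hq] with z hz hz'
    rw [hz, hz']

/-- Within `Ω`, `r` is at least `δ` where `φ` is nonzero, so the weight can be divided out. -/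
theorem memLp_of_vanish {f φ : Cyl → ℝ} {β δ : ℝ} (hδ : 0 < δ)
    (hf : MemLp (fun z => z.2 ^ β * f z) 2 (volume.restrict Omega))
    (h0 : ∀ z ∈ Omega, z.2 < δ → φ z = 0) (hφ : IsSmooth φ) :
    MemLp (fun z => f z * φ z) 2 (volume.restrict Omega) := by
  have h1 := memLp_indicator_mul hf (half_pos hδ)
  obtain ⟨C, hC0, hC⟩ := hφ.exists_bound
  have h2 : MemLp (fun z : Cyl => φ z * ((Ioi (δ / 2)).indicator (fun _ => (1 : ℝ)) z.2 * f z)) 2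
      (volume.restrict Omega) := by
    refine MemLp.of_le_mul (c := C) h1 (hφ.continuous.aestronglyMeasurable.mul
      h1.aestronglyMeasurable) (ae_Omega fun z hz => ?_)
    rw [norm_mul]
    exact mul_le_mul_of_nonneg_right (hC z hz) (norm_nonneg _)
  refine memLp_congr_Omega h2 fun z hz => ?_
  by_cases h : z.2 ∈ Ioi (δ / 2)
  · rw [indicator_of_mem h]; ring
  · rw [h0 z hz (by have := not_lt.1 (mem_Ioi.not.1 h); linarith)]; ring

/-- Elements of `H^1_Γ` have zero trace on `Γ`. -/
theorem IsH1Gamma.integral_eq_zero (h : IsH1Gamma α u p q) (hα : 0 ≤ α) {ψ : Cyl → ℝ}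
    (hψ : IsSmoothGammaStar ψ) :
    ∫ z in Omega, (u z * dE (0, 1) ψ z + q z * ψ z) = 0 := by
  obtain ⟨hψs, δ₀, hδ₀, hψ0⟩ := hψ
  -- `q` is controlled only with the weight `r^{α/2}`; the inverse weight is put on `ψ`, which
  -- vanishes near `Γ^*`.
  have hw : MemLp (fun z : Cyl => z.2 ^ (-(α / 2)) * ψ z) 2 (volume.restrict Omega) := by
    refine memLp_of_vanish (β := α / 2) hδ₀ ?_ hψ0 hψs
    refine memLp_congr_Omega (f := fun _ => 1) (memLp_const 1) fun z hz => ?_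
    rw [← rpow_add hz.1]; simp
  have hdψ := (hψs.dE (0, 1)).memLp 2
  set M := n2 Omega (dE (0, 1) ψ) + n2 Omega (fun z : Cyl => z.2 ^ (-(α / 2)) * ψ z) with hM
  have hM0 : 0 ≤ M := add_nonneg (n2_nonneg _ _) (n2_nonneg _ _)
  have key : ∀ η > 0, |∫ z in Omega, (u z * dE (0, 1) ψ z + q z * ψ z)| ≤ η * M := by
    intro η hη
    obtain ⟨φ, ⟨hφs, δ₁, hδ₁, hφ0⟩, hlt⟩ := h.2 (η ^ 2) (by positivity)
    have hd := h.1.sub_smooth hφs hα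
    -- `φ` vanishes near `Γ` and `ψ` near `Γ^*`, so on `Ω` the product is a test function; its
    -- radial derivative has integral zero, as testing the constant `1` shows.
    have hzero : ∫ z in Omega, (φ z * dE (0, 1) ψ z + dE (0, 1) φ z * ψ z) = 0 := by
      set δ := min δ₀ δ₁ / 4 with hδ
      have hδp : 0 < δ := by have := lt_min hδ₀ hδ₁; positivity
      have hT := isTest_cut2_mul (hφs.mul hψs) hδp
      have hEq : EqOn (fun z : Cyl => cut2 δ z.2 * (φ z * ψ z)) (fun z => φ z * ψ z) Omega := by
        intro z hz
        by_cases h1 : z.2 < δ₀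
        · simp [hψ0 z hz h1]
        by_cases h2 : 1 - δ₁ < z.2
        · simp [hφ0 z hz h2]
        · have := min_le_left δ₀ δ₁
          have := min_le_right δ₀ δ₁
          simp only
          rw [cut2_eq_one hδp (by linarith) (by linarith), one_mul]
      have h1 := (isSmooth_const 1).wd (0, 1) _ hT
      simp only [dE_const, zero_mul, one_mul, integral_zero, neg_zero] at h1
      refine Eq.trans (setIntegral_congr_fun measurableSet_Omega fun z hz => ?_) h1
      rw [dE_congr_Omega hEq (0, 1) hz, dE_mul hφs hψs]; ring
    have hk := hd.memLp_r
    have i1 : Integrable (fun z => (u z - φ z) * dE (0, 1) ψ z) (volume.restrict Omega) :=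
      integrable_mul_of_memLp hd.memLp hdψ
    have i2 : Integrable (fun z => z.2 ^ (α / 2) * (q z - dR φ z) * (z.2 ^ (-(α / 2)) * ψ z))
      (volume.restrict Omega) := integrable_mul_of_memLp hk hw
    have i3 : Integrable (fun z => φ z * dE (0, 1) ψ z + dE (0, 1) φ z * ψ z)
        (volume.restrict Omega) :=
      (integrable_mul_of_memLp (hφs.memLp 2) hdψ).add
        (integrable_mul_of_memLp ((hφs.dE _).memLp 2) (hψs.memLp 2))
    have e : ∫ z in Omega, (u z * dE (0, 1) ψ z + q z * ψ z)
        = (∫ z in Omega, (u z - φ z) * dE (0, 1) ψ z)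
          + ∫ z in Omega, z.2 ^ (α / 2) * (q z - dR φ z) * (z.2 ^ (-(α / 2)) * ψ z) := by
      refine Eq.trans ?_ (add_zero _)
      refine Eq.trans ?_ (congrArg _ hzero)
      rw [← integral_add_add i1 i2 i3]
      refine setIntegral_congr_fun measurableSet_Omega fun z hz => ?_
      have : z.2 ^ (α / 2) * z.2 ^ (-(α / 2)) = 1 := by rw [← rpow_add hz.1]; simp
      simp only [dR_eq]
      linear_combination (-(q z - dE (0, 1) φ z) * ψ z) * this
    have b0 : ∀ f : Cyl → ℝ, (∫ z in Omega, f z ^ 2 ≤ ∫ z, ((u z - φ z) ^ 2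
        + (p z - dTheta φ z) ^ 2 + z.2 ^ α * (q z - dR φ z) ^ 2) ∂muOmega) → n2 Omega f ≤ η := by
      intro f hf
      have : n2 Omega f ^ 2 ≤ η ^ 2 := by rw [n2_sq]; exact hf.trans hlt.le
      exact (pow_le_pow_iff_left₀ (n2_nonneg _ _) hη.le (by norm_num)).1 this
    have b1 : n2 Omega (fun z => u z - φ z) ≤ η := b0 _ <|
      integral_mono_ae hd.memLp.integrable_sq hd.integrable_energy (ae_Omega fun z hz => by
        have : 0 ≤ z.2 ^ α := rpow_nonneg hz.1.le _
        have := mul_nonneg this (sq_nonneg (q z - dR φ z))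
        simp only
        linarith [sq_nonneg (p z - dTheta φ z)])
    have b2 : n2 Omega (fun z => z.2 ^ (α / 2) * (q z - dR φ z)) ≤ η := b0 _ <|
      integral_mono_ae hk.integrable_sq hd.integrable_energy (ae_Omega fun z hz => by
        simp only [rpow_half_mul_sq hz.1]
        linarith [sq_nonneg (p z - dTheta φ z), sq_nonneg (u z - φ z)])
    rw [e]
    refine (abs_add_le _ _).trans ?_
    rw [hM, mul_add]
    exact add_le_add
      ((abs_integral_mul_le hd.memLp hdψ).trans (mul_le_mul_of_nonneg_right b1 (n2_nonneg _ _)))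
      ((abs_integral_mul_le hk hw).trans (mul_le_mul_of_nonneg_right b2 (n2_nonneg _ _)))
  by_contra hne
  have hp := abs_pos.2 hne
  have := key (|∫ z in Omega, (u z * dE (0, 1) ψ z + q z * ψ z)| / (2 * (M + 1))) (by positivity)
  rw [div_mul_eq_mul_div, le_div_iff₀ (by positivity)] at this
  nlinarith

end

/-! ### Tangential regularity of the weak solution -/

/-- Discrete integration by parts for the second difference. -/
theorem integral_mul_second_difference {e : ℝ × ℝ} {U : Set Cyl} (hU : ShiftInvariant e U)
    {f : Cyl → ℝ} (hf : MemLp f 2 (volume.restrict U)) (t : ℝ) :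
    ∫ z in U, f z * (f (shift e t z) + f (shift e (-t) z) + -2 * f z)
      = -n2 U (fun z => f (shift e t z) - f z) ^ 2 := by
  have h1 := hf.comp_shift hU t
  have h2 := hf.comp_shift hU (-t)
  have i1 := integrable_mul_of_memLp hf h1
  have i2 := integrable_mul_of_memLp hf h2
  have i3 := integrable_mul_of_memLp hf hf
  have i4 := integrable_mul_of_memLp h1 h1
  have e1 : ∫ z in U, f z * f (shift e (-t) z) = ∫ z in U, f z * f (shift e t z) := by
    rw [← integral_comp_shift_mul hU]
    congr 1; funext z; ring
  have e2 : ∫ z in U, f (shift e t z) * f (shift e t z) = ∫ z in U, f z * f z :=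
    integral_comp_shift hU t (fun z => f z * f z)
  have e3 : ∫ z in U, f z * (f (shift e t z) + f (shift e (-t) z) + -2 * f z)
      = (∫ z in U, f z * f (shift e t z)) + (∫ z in U, f z * f (shift e (-t) z))
        + -2 * ∫ z in U, f z * f z := by
    rw [← integral_const_mul, ← integral_add_add i1 i2 (i3.const_mul _)]
    congr 1; funext z; ring
  have e4 : ∫ z in U, (f (shift e t z) - f z) ^ 2
      = (∫ z in U, f (shift e t z) * f (shift e t z)) + -2 * (∫ z in U, f z * f (shift e t z))
        + ∫ z in U, f z * f z := by
    rw [← integral_const_mul, ← integral_add_add i4 (i1.const_mul _) i3]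
    congr 1; funext z; ring
  rw [n2_sq, e3, e4, e1, e2]; ring

section

variable {α : ℝ} {g u p q : Cyl → ℝ}

theorem integral_split_weight {q' p' : Cyl → ℝ}
    (hp : MemLp p 2 (volume.restrict Omega)) (hp' : MemLp p' 2 (volume.restrict Omega))
    (hq : MemLp (fun z => z.2 ^ (α / 2) * q z) 2 (volume.restrict Omega))
    (hq' : MemLp (fun z => z.2 ^ (α / 2) * q' z) 2 (volume.restrict Omega)) :
    ∫ z, (p z * p' z + z.2 ^ α * (q z * q' z)) ∂muOmega
      = (∫ z in Omega, p z * p' z)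
        + ∫ z in Omega, z.2 ^ (α / 2) * q z * (z.2 ^ (α / 2) * q' z) := by
  rw [← integral_add (integrable_mul_of_memLp hp hp') (integrable_mul_of_memLp hq hq')]
  refine setIntegral_congr_fun measurableSet_Omega fun z hz => ?_
  have : z.2 ^ (α / 2) * z.2 ^ (α / 2) = z.2 ^ α := by rw [← rpow_add hz.1]; simp
  simp only [← this]; ring

/-- Tangential difference quotients of the gradient of the weak solution are bounded. -/
theorem IsWeakSolution.n2_difference_le (hu : IsWeakSolution α g u) (hα : 0 ≤ α)
    (hg : MemLp g 2 (volume.restrict Omega)) (h : IsH1Gamma α u p q) (t : ℝ) :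
    n2 Omega (fun z => p (shift (1, 0) t z) - p z) ≤ |t| * n2 Omega g ∧
    n2 Omega (fun z => z.2 ^ (α / 2) * q (shift (1, 0) t z) - z.2 ^ (α / 2) * q z)
      ≤ |t| * n2 Omega g := by
  have hS := shiftInvariant_Omega
  -- Nirenberg's test function: discrete integration by parts turns the left side of the equation
  -- into minus the squared norms of the increments of `p` and `r^{α/2} q`.
  have hv := ((h.comp_shift t).add (h.comp_shift (-t)) hα).add (h.const_mul (-2)) hα
  have hweak := hu.weak p q h.1.grad _ hv.memH1Gamma _ _ hv.1.grad
  have hk := h.1.memLp_r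
  rw [integral_split_weight h.1.memLp_theta hv.1.memLp_theta hk hv.1.memLp_r,
    integral_mul_second_difference hS h.1.memLp_theta] at hweak
  have e2 := integral_mul_second_difference hS hk t
  simp only [shift_theta_snd] at e2
  have e3 : ∀ z : Cyl, z.2 ^ (α / 2) * (q (shift (1, 0) t z) + q (shift (1, 0) (-t) z) + -2 * q z)
      = z.2 ^ (α / 2) * q (shift (1, 0) t z) + z.2 ^ (α / 2) * q (shift (1, 0) (-t) z)
        + -2 * (z.2 ^ (α / 2) * q z) := fun z => by ring
  simp only [e3] at hweak
  rw [e2] at hweak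
  set X := n2 Omega (fun z => p (shift (1, 0) t z) - p z)
  set Y := n2 Omega (fun z => z.2 ^ (α / 2) * q (shift (1, 0) t z) - z.2 ^ (α / 2) * q z)
  have hX : 0 ≤ X := n2_nonneg _ _
  have hY : 0 ≤ Y := n2_nonneg _ _
  have hG : 0 ≤ n2 Omega g := n2_nonneg _ _
  -- Up to sign, the second difference is the increment under `-t` of `u(shift t ·) - u`, whose
  -- tangential derivative has norm `X`; hence the bound `|t| X`.
  have hw := (h.comp_shift t).1.add (h.1.const_mul (-1))
  simp only [neg_mul, one_mul, ← sub_eq_add_neg] at hw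
  obtain ⟨hw1, hw2, -, hw4, -⟩ := isH1w_iff.1 hw
  have hb := hw4.n2_shift_sub_le hS isOpen_Omega hw1 hw2 (-t)
  simp only [shift_shift, neg_add_cancel, shift_zero, abs_neg] at hb
  have hv2 : n2 Omega (fun z => u (shift (1, 0) t z) + u (shift (1, 0) (-t) z) + -2 * u z)
      ≤ |t| * X := by
    refine le_trans (le_of_eq ?_) hb
    simp only [n2]
    congr 2; funext z; ring
  have hle : |∫ z in Omega, g z * (u (shift (1, 0) t z) + u (shift (1, 0) (-t) z) + -2 * u z)|
      ≤ n2 Omega g * (|t| * X) :=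
    (abs_integral_mul_le hg hv.1.memLp).trans (mul_le_mul_of_nonneg_left hv2 hG)
  have hmain : X ^ 2 + Y ^ 2 ≤ n2 Omega g * (|t| * X) := by
    have := (abs_le.1 hle).1
    rw [muOmega] at hweak
    linarith
  -- Dropping `Y²` bounds `X`; inserting that bound into `hmain` then bounds `Y`.
  have hXle : X ≤ |t| * n2 Omega g := by
    by_contra! hc
    nlinarith [sq_nonneg Y, mul_nonneg (abs_nonneg t) hG]
  refine ⟨hXle, ?_⟩
  have ht := mul_nonneg (abs_nonneg t) hG
  have : Y ^ 2 ≤ (|t| * n2 Omega g) ^ 2 := by nlinarith [sq_nonneg X]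
  exact (pow_le_pow_iff_left₀ hY ht (by norm_num)).1 this

theorem contDiffOn_rpow_Ioi (a : ℝ) : ContDiffOn ℝ ∞ (fun r : ℝ => r ^ a) (Ioi 0) := fun _ hr =>
  (contDiffAt_rpow_const_of_ne (ne_of_gt hr)).contDiffWithinAt

theorem deriv_rpow_of_pos {r : ℝ} (hr : 0 < r) (a : ℝ) :
    deriv (fun r : ℝ => r ^ a) r = a * r ^ (a - 1) :=
  (Real.hasDerivAt_rpow_const (Or.inl hr.ne')).deriv

theorem WD.rpow_mul_theta {f P : Cyl → ℝ} (h : WD (1, 0) Omega f P)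
    (hf : LocallyIntegrableOn f Omega) (hP : LocallyIntegrableOn P Omega) (a : ℝ) :
    WD (1, 0) Omega (fun z => z.2 ^ a * f z) (fun z => z.2 ^ a * P z) :=
  (h.mul_snd hf hP (contDiffOn_rpow_Ioi a)).congr (fun _ _ => rfl) fun z _ => by simp

theorem WD.rpow_mul_r {f Q : Cyl → ℝ} (h : WD (0, 1) Omega f Q)
    (hf : LocallyIntegrableOn f Omega) (hQ : LocallyIntegrableOn Q Omega) (a : ℝ) :
    WD (0, 1) Omega (fun z => z.2 ^ a * f z)
      (fun z => a * (z.2 ^ (a - 1) * f z) + z.2 ^ a * Q z) :=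
  (h.mul_snd hf hQ (contDiffOn_rpow_Ioi a)).congr (fun _ _ => rfl) fun z hz => by
    simp only [deriv_rpow_of_pos hz.1]; ring

/-- Second-order tangential regularity: `∂_θ∂_θ u = P` and `∂_θ∂_r u = r^{-α/2} R` with
`P, R ∈ L²`, and `∂_r (r^α ∂_r u) = -(g + P)`. -/
theorem IsWeakSolution.regularity (hu : IsWeakSolution α g u) (hα : 0 ≤ α)
    (hg : MemLp g 2 (volume.restrict Omega)) (h : IsH1Gamma α u p q) :
    ∃ P R, MemLp P 2 (volume.restrict Omega) ∧ MemLp R 2 (volume.restrict Omega) ∧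
      WD (1, 0) Omega p P ∧ WD (0, 1) Omega p (fun z => z.2 ^ (-(α / 2)) * R z) ∧
      WD (1, 0) Omega q (fun z => z.2 ^ (-(α / 2)) * R z) ∧
      WD (1, 0) Omega (fun z => z.2 ^ α * q z) (fun z => z.2 ^ (α / 2) * R z) ∧
      WD (0, 1) Omega (fun z => z.2 ^ α * q z) (fun z => -(g z + P z)) := by
  have hS := shiftInvariant_Omega
  obtain ⟨a1, a2, a3, a4, a5⟩ := isH1w_iff.1 h.1
  obtain ⟨P, hP, hWP⟩ := exists_WD_of_n2_shift_sub_le hS a2 (C := n2 Omega g)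
    fun t => (hu.n2_difference_le hα hg h t).1
  obtain ⟨R, hR, hWR⟩ := exists_WD_of_n2_shift_sub_le hS a3 (C := n2 Omega g)
    fun t => by simpa only [shift_theta_snd] using (hu.n2_difference_le hα hg h t).2
  have lk := locallyIntegrableOn_Omega_of_memLp a3
  have lR := locallyIntegrableOn_Omega_of_memLp hR
  have hq : WD (1, 0) Omega q (fun z => z.2 ^ (-(α / 2)) * R z) :=
    (hWR.rpow_mul_theta lk lR (-(α / 2))).congr (fun z hz => by
      rw [← mul_assoc, ← rpow_add hz.1]; simp) fun _ _ => rfl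
  have hv : WD (1, 0) Omega (fun z => z.2 ^ α * q z) (fun z => z.2 ^ (α / 2) * R z) :=
    (hWR.rpow_mul_theta lk lR (α / 2)).congr (fun z hz => by
      rw [← mul_assoc, ← rpow_add hz.1, add_halves]) fun _ _ => rfl
  refine ⟨P, R, hP, hR, hWP, fun φ hφ => ?_, hq, hv, fun φ hφ => ?_⟩
  -- `∂_r p = ∂_θ q`: test `∂_θ u = p` with `∂_r φ` and `∂_r u = q` with `∂_θ φ`.
  · have h1 := a4 _ (hφ.dE (0, 1))
    have h2 := a5 _ (hφ.dE (1, 0))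
    have h3 := hq _ hφ
    simp only [dE_comm hφ.smooth (1, 0) (0, 1)] at h1
    linarith
  -- Once `∂_θ p = P` is an `L²` function, the weak equation leaves only the radial derivative of
  -- the flux.
  · have hφΓ := hφ.isSmoothGamma.isH1Gamma hα
    have hweak := hu.weak p q h.1.grad φ hφΓ.memH1Gamma _ _ hφΓ.1.grad
    have i1 : Integrable (fun z => p z * dE (1, 0) φ z) (volume.restrict Omega) :=
      integrable_mul_test h.1.grad.locInt_theta (hφ.dE _)
    have lv : LocallyIntegrableOn (fun z => z.2 ^ α * q z) Omega :=
      locallyIntegrableOn_Omega_of_memLp (memLp_rpow_mono a3 (by linarith))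
    have i2 : Integrable (fun z => z.2 ^ α * q z * dE (0, 1) φ z) (volume.restrict Omega) :=
      integrable_mul_test lv (hφ.dE _)
    have i3 := integrable_mul_of_memLp hg (hφ.memLp (V := Omega) 2)
    have i4 := integrable_mul_of_memLp hP (hφ.memLp (V := Omega) 2)
    have h1 := hWP _ hφ
    rw [dTheta_eq, dR_eq, muOmega] at hweak
    simp only [← mul_assoc] at hweak
    rw [integral_add i1 i2, h1] at hweak
    simp only [neg_mul, add_mul]
    rw [integral_neg, integral_add i3 i4]
    linarith

end

/-! ### Tangential integration by parts up to `Γ`; gradients of `r^κ f²` and `r^κ f` -/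

/-- Testing a tangential weak derivative with functions that need not vanish near `Γ`. -/
theorem WD.integral_theta {f P φ : Cyl → ℝ} {β γ : ℝ} (h : WD (1, 0) Omega f P)
    (hf : MemLp (fun z => z.2 ^ β * f z) 2 (volume.restrict Omega))
    (hP : MemLp (fun z => z.2 ^ γ * P z) 2 (volume.restrict Omega)) (hφ : IsSmoothGammaStar φ) :
    Integrable (fun z => f z * dE (1, 0) φ z) (volume.restrict Omega) ∧
    Integrable (fun z => P z * φ z) (volume.restrict Omega) ∧
    ∫ z in Omega, f z * dE (1, 0) φ z = -∫ z in Omega, P z * φ z := by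
  obtain ⟨hs, δ₀, hδ₀, h0⟩ := hφ
  have h0' : ∀ z ∈ Omega, z.2 < δ₀ → dE (1, 0) φ z = 0 := fun z hz hr => by
    refine eq_zero_of_eventuallyEq ?_ _
    filter_upwards [isOpen_Omega.mem_nhds hz,
      (isOpen_lt continuous_snd continuous_const).mem_nhds hr] with y hy hy'
    exact h0 y hy hy'
  have i1 := integrable_of_memLp_two (memLp_of_vanish hδ₀ hf h0' (hs.dE _))
  have i2 := integrable_of_memLp_two (memLp_of_vanish hδ₀ hP h0 hs)
  refine ⟨i1, i2, ?_⟩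
  have hcs : ∀ δ : ℝ, ContDiff ℝ ∞ (fun r => cut δ (1 - r)) := fun δ =>
    (contDiff_cut δ).comp (by fun_prop)
  let G : Cyl → ℝ := fun z => f z * dE (1, 0) φ z + P z * φ z
  have hG : Integrable G (volume.restrict Omega) := i1.add i2
  -- The cut-off near `Γ` depends on `r` alone, so `∂_θ` does not see it and no boundary term
  -- arises.
  have hH0 : ∀ᶠ δ in 𝓝[>] (0 : ℝ), ∫ z in Omega, cut δ (1 - z.2) * G z = 0 := by
    filter_upwards [Ioo_mem_nhdsGT (show 0 < δ₀ / 2 by positivity)] with δ hδ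
    have hT := isTest_cut2_mul hs hδ.1
    have hEq : EqOn (fun z : Cyl => cut2 δ z.2 * φ z) (fun z => cut δ (1 - z.2) * φ z) Omega := by
      intro z hz
      by_cases h1 : z.2 < δ₀
      · simp [h0 z hz h1]
      · have h2 : cut δ z.2 = 1 := cut_eq_one hδ.1 (by linarith [hδ.2, not_lt.1 h1])
        simp [cut2, h2]
    have h1 := h _ hT
    have hdEq : ∀ z ∈ Omega, dE (1, 0) (fun z : Cyl => cut2 δ z.2 * φ z) z
        = cut δ (1 - z.2) * dE (1, 0) φ z := by
      intro z hz
      rw [dE_congr_Omega hEq (1, 0) hz, dE_mul (isSmooth_snd (hcs δ)) hs,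
        dE_snd (differentiable_of_contDiff (hcs δ))]
      simp
    have e1 : ∫ z in Omega, f z * dE (1, 0) (fun z : Cyl => cut2 δ z.2 * φ z) z
        = ∫ z in Omega, cut δ (1 - z.2) * (f z * dE (1, 0) φ z) :=
      setIntegral_congr_fun measurableSet_Omega fun z hz => by simp only [hdEq z hz]; ring
    have e2 : ∫ z in Omega, P z * (cut2 δ z.2 * φ z)
        = ∫ z in Omega, cut δ (1 - z.2) * (P z * φ z) :=
      setIntegral_congr_fun measurableSet_Omega fun z hz => by
        have : cut2 δ z.2 * φ z = cut δ (1 - z.2) * φ z := hEq hz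
        simp only [this]; ring
    rw [e1, e2] at h1
    have j : ∀ {F : Cyl → ℝ}, Integrable F (volume.restrict Omega) →
        Integrable (fun z : Cyl => cut δ (1 - z.2) * F z) (volume.restrict Omega) := fun hF =>
      (integrable_bdd_mul_Omega hF (isSmooth_snd (hcs δ))).congr
        (Eventually.of_forall fun z => mul_comm _ _)
    simp only [G, mul_add]
    rw [integral_add (j i1) (j i2), h1]; ring
  have hlim : Tendsto (fun δ => ∫ z in Omega, cut δ (1 - z.2) * G z) (𝓝[>] 0)
      (𝓝 (∫ z in Omega, G z)) := by
    refine tendsto_integral_filter_of_dominated_convergence (fun z => |G z|) ?_ ?_ hG.abs ?_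
    · exact Eventually.of_forall fun δ =>
        (isSmooth_snd (hcs δ)).continuous.aestronglyMeasurable.mul hG.aestronglyMeasurable
    · refine Eventually.of_forall fun δ => Eventually.of_forall fun z => ?_
      rw [norm_mul, Real.norm_of_nonneg (cut_nonneg _ _)]
      exact mul_le_of_le_one_left (norm_nonneg _) (cut_le_one _ _)
    · refine ae_Omega fun z hz => ?_
      simpa using (tendsto_cut (sub_pos.2 hz.2)).mul_const (G z)
  have h1 := tendsto_nhds_unique hlim (tendsto_const_nhds.congr' (hH0.mono fun _ h => h.symm))
  simp only [G] at h1
  rw [integral_add i1 i2] at h1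
  linarith

/-- The weak gradient of `r^κ f²`. -/
theorem isWeakGrad_rpow_mul_sq {f P Q : Cyl → ℝ} {a b c κ : ℝ}
    (hP : WD (1, 0) Omega f P) (hQ : WD (0, 1) Omega f Q)
    (mf : MemLp (fun z => z.2 ^ a * f z) 2 (volume.restrict Omega))
    (mP : MemLp (fun z => z.2 ^ b * P z) 2 (volume.restrict Omega))
    (mQ : MemLp (fun z => z.2 ^ c * Q z) 2 (volume.restrict Omega))
    (hab : a + b ≤ κ) (hac : a + c ≤ κ)
    (hI : Integrable (fun z => z.2 ^ (κ - 1) * f z ^ 2) (volume.restrict Omega)) :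
    ∃ p q, IsWeakGrad (fun z => z.2 ^ κ * f z ^ 2) p q ∧
      Integrable (fun z => z.2 ^ κ * f z ^ 2) (volume.restrict Omega) ∧
      Integrable p (volume.restrict Omega) ∧ Integrable q (volume.restrict Omega) := by
  -- `hI` serves both the derivative of the power and, with the smaller weight `r^κ`, the function
  -- itself. The cross terms are integrable by Cauchy-Schwarz and the two exponent conditions.
  have iκ : Integrable (fun z => z.2 ^ κ * f z ^ 2) (volume.restrict Omega) :=
    memLp_one_iff_integrable.1 (memLp_rpow_mono (memLp_one_iff_integrable.2 hI) (by linarith))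
  have iP : Integrable (fun z => z.2 ^ κ * (2 * f z * P z)) (volume.restrict Omega) :=
    ((integrable_rpow_mul mf mP hab).const_mul 2).congr
      (Eventually.of_forall fun z => by simp only; ring)
  have iQ : Integrable (fun z => z.2 ^ κ * (2 * f z * Q z)) (volume.restrict Omega) :=
    ((integrable_rpow_mul mf mQ hac).const_mul 2).congr
      (Eventually.of_forall fun z => by simp only; ring)
  have lf := locallyIntegrableOn_Omega_of_rpow le_rfl (memLp_one_iff_integrable.2 hI)
  have lP := locallyIntegrableOn_Omega_of_rpow le_rfl (memLp_one_iff_integrable.2 iP)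
  have lQ := locallyIntegrableOn_Omega_of_rpow le_rfl (memLp_one_iff_integrable.2 iQ)
  have iR := (hI.const_mul κ).add iQ
  exact ⟨_, _, isWeakGrad_iff.2 ⟨locallyIntegrableOn_of_integrable iκ Omega_subset_closedStrip,
    locallyIntegrableOn_of_integrable iP Omega_subset_closedStrip,
    locallyIntegrableOn_of_integrable iR Omega_subset_closedStrip,
    (hP.sq_of_rpow mf mP).rpow_mul_theta lf lP κ, (hQ.sq_of_rpow mf mQ).rpow_mul_r lf lQ κ⟩,
    iκ, iP, iR⟩

/-- The weak gradient of `r^κ f`. -/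
theorem isWeakGrad_rpow_mul {f P Q : Cyl → ℝ} {c κ : ℝ} {m : ℝ≥0∞} (hm : 1 ≤ m)
    (hP : WD (1, 0) Omega f P) (hQ : WD (0, 1) Omega f Q)
    (mP : MemLp P m (volume.restrict Omega))
    (mQ : MemLp (fun z => z.2 ^ c * Q z) m (volume.restrict Omega))
    (h0 : 0 ≤ κ) (hc : c ≤ κ)
    (hI : MemLp (fun z => z.2 ^ (κ - 1) * f z) m (volume.restrict Omega)) :
    ∃ p q, IsWeakGrad (fun z => z.2 ^ κ * f z) p q ∧
      MemLp (fun z => z.2 ^ κ * f z) m (volume.restrict Omega) ∧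
      MemLp p m (volume.restrict Omega) ∧ MemLp q m (volume.restrict Omega) := by
  have iκ : MemLp (fun z => z.2 ^ κ * f z) m (volume.restrict Omega) :=
    memLp_rpow_mono hI (by linarith)
  have iP : MemLp (fun z => z.2 ^ κ * P z) m (volume.restrict Omega) :=
    memLp_rpow_mono (memLp_zero_rpow mP) h0
  have iQ : MemLp (fun z => z.2 ^ κ * Q z) m (volume.restrict Omega) := memLp_rpow_mono mQ hc
  have lf := locallyIntegrableOn_Omega_of_rpow hm hI
  have lP := locallyIntegrableOn_Omega_of_rpow hm iP
  have lQ := locallyIntegrableOn_Omega_of_rpow hm iQ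
  have iR := (hI.const_mul κ).add iQ
  exact ⟨_, _, isWeakGrad_iff.2
    ⟨locallyIntegrableOn_of_integrable (iκ.integrable hm) Omega_subset_closedStrip,
    locallyIntegrableOn_of_integrable (iP.integrable hm) Omega_subset_closedStrip,
    locallyIntegrableOn_of_integrable (iR.integrable hm) Omega_subset_closedStrip,
    hP.rpow_mul_theta lf lP κ, hQ.rpow_mul_r lf lQ κ⟩, iκ, iP, iR⟩

theorem IsWeakGrad.congr {f f' p q : Cyl → ℝ} (h : IsWeakGrad f p q)
    (hf : ∀ z ∈ Omega, f z = f' z) : IsWeakGrad f' p q := by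
  obtain ⟨h1, h2, h3, h4, h5⟩ := isWeakGrad_iff.1 h
  refine isWeakGrad_iff.2 ⟨fun x hx => ?_, h2, h3, h4.congr hf fun _ _ => rfl,
    h5.congr hf fun _ _ => rfl⟩
  obtain ⟨s, hs, hi⟩ := h1 x hx
  rw [isOpen_Omega.nhdsWithin_eq hx] at hs ⊢
  obtain ⟨t, hts, hto, hxt⟩ := mem_nhds_iff.1 hs
  exact ⟨t ∩ Omega, (hto.inter isOpen_Omega).mem_nhds ⟨hxt, hx⟩,
    (hi.mono_set (inter_subset_left.trans hts)).congr_fun (fun z hz => hf z hz.2)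
      (hto.inter isOpen_Omega).measurableSet⟩

theorem IsWeakGrad.add {f p q f' p' q' : Cyl → ℝ} (h : IsWeakGrad f p q)
    (h' : IsWeakGrad f' p' q') :
    IsWeakGrad (fun z => f z + f' z) (fun z => p z + p' z) (fun z => q z + q' z) := by
  obtain ⟨h1, h2, h3, h4, h5⟩ := isWeakGrad_iff.1 h
  obtain ⟨k1, k2, k3, k4, k5⟩ := isWeakGrad_iff.1 h'
  exact isWeakGrad_iff.2 ⟨h1.add k1, h2.add k2, h3.add k3, h4.add k4 h1 h2 k1 k2,
    h5.add k5 h1 h3 k1 k3⟩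

/-! ### The three conclusions -/

section

variable {α : ℝ} {g u p q : Cyl → ℝ}

/-- `∂_θ u = 0` on `Γ`. -/
theorem IsH1Gamma.vanishesOnGamma_theta (h : IsH1Gamma α u p q) (hα : 0 ≤ α) {P R : Cyl → ℝ}
    (hP : MemLp P 2 (volume.restrict Omega)) (hR : MemLp R 2 (volume.restrict Omega))
    (hpP : WD (1, 0) Omega p P) (hpR : WD (0, 1) Omega p (fun z => z.2 ^ (-(α / 2)) * R z))
    (hqR : WD (1, 0) Omega q (fun z => z.2 ^ (-(α / 2)) * R z)) : VanishesOnGamma p := by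
  obtain ⟨a1, a2, a3, a4, a5⟩ := isH1w_iff.1 h.1
  have hS : MemLp (fun z : Cyl => z.2 ^ (α / 2) * (z.2 ^ (-(α / 2)) * R z)) 2
      (volume.restrict Omega) :=
    memLp_congr_Omega hR fun z hz => by rw [← mul_assoc, ← rpow_add hz.1]; simp
  have l1 := locallyIntegrableOn_of_rpow (by norm_num) (memLp_zero_rpow a2)
  have l2 := locallyIntegrableOn_of_rpow (by norm_num) (memLp_zero_rpow hP)
  have l3 := locallyIntegrableOn_of_rpow (by norm_num) hS
  have hsub : Omega ⊆ {z : Cyl | 0 < z.2 ∧ z.2 ≤ 1} := fun z hz => ⟨hz.1, hz.2.le⟩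
  refine ⟨integrable_zero _ _ _, P, fun z => z.2 ^ (-(α / 2)) * R z, isWeakGrad_iff.2
    ⟨l1.mono_set hsub, l2.mono_set hsub, l3.mono_set hsub, hpP, hpR⟩, l1, l2, l3, fun φ hφ => ?_⟩
  obtain ⟨hs, δ, hδ, h0⟩ := hφ
  have hvan : ∀ e : ℝ × ℝ, IsSmoothGammaStar (dE e φ) := fun e =>
    ⟨hs.dE e, δ, hδ, fun z hz hr => by
      refine eq_zero_of_eventuallyEq ?_ _
      filter_upwards [isOpen_Omega.mem_nhds hz,
        (isOpen_lt continuous_snd continuous_const).mem_nhds hr] with y hy hy'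
      exact h0 y hy hy'⟩
  -- Both tangential derivatives are moved onto `φ`, which leaves minus the Gauss-Green integral of
  -- `u` against `∂_θ φ`; it vanishes since `u = 0` on `Γ`.
  obtain ⟨i1, i2, h1⟩ := a4.integral_theta (memLp_zero_rpow a1) (memLp_zero_rpow a2) (hvan (0, 1))
  obtain ⟨i3, i4, h2⟩ := hqR.integral_theta a3 hS ⟨hs, δ, hδ, h0⟩
  have h3 := h.integral_eq_zero hα (hvan (1, 0))
  simp only [dE_comm hs (0, 1) (1, 0)] at h3
  rw [integral_add i1 i3] at h3
  simp only [zero_mul, integral_zero]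
  rw [dR_eq, muOmega, integral_add i2 i4]
  linarith

theorem IsWeakGrad.memW1_one {f P Q : Cyl → ℝ} (h : IsWeakGrad f P Q)
    (hf : Integrable f (volume.restrict Omega)) (hP : Integrable P (volume.restrict Omega))
    (hQ : Integrable Q (volume.restrict Omega)) : MemW1 1 f :=
  ⟨memLp_one_iff_integrable.2 hf, P, Q, h, memLp_one_iff_integrable.2 hP,
    memLp_one_iff_integrable.2 hQ⟩

/-- `r^{α/2} u² ∈ W^{1,1}(Ω)`. -/
theorem IsH1w.memW1_sq (h : IsH1w α u p q) (hα : α ∈ Ico (1 : ℝ) 2) :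
    MemW1 1 (fun z => z.2 ^ (α / 2) * u z ^ 2) := by
  obtain ⟨a1, a2, a3, a4, a5⟩ := isH1w_iff.1 h
  obtain ⟨hα1, hα2⟩ := hα
  -- `s - 1` is the exponent produced by `∂_r r^{α/2}`, and `2β ≤ s + 1` with `β = α/2` amounts to
  -- `α ≤ 2`.
  have hI := hardy (s := α / 2) (by linarith) (by linarith) a5 a1 a3
  obtain ⟨P, Q, h1, h2, h3, h4⟩ := isWeakGrad_rpow_mul_sq (κ := α / 2) a4 a5 (memLp_zero_rpow a1)
    (memLp_zero_rpow a2) a3 (by linarith) (by linarith) hI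
  exact h1.memW1_one h2 h3 h4

/-- `r^{α/2+ε} u ∈ H^1(Ω)`. -/
theorem IsH1w.memW1_rpow_mul (h : IsH1w α u p q) (hα : α ∈ Ico (1 : ℝ) 2) {ε : ℝ} (hε : 0 ≤ ε)
    (hε' : α = 1 → 0 < ε) : MemW1 2 (fun z => z.2 ^ (α / 2 + ε) * u z) := by
  obtain ⟨a1, a2, a3, a4, a5⟩ := isH1w_iff.1 h
  obtain ⟨hα1, hα2⟩ := hα
  -- Here `s - 1 = 2 (α/2 + ε - 1)`, the exponent needed for `r^{α/2+ε-1} u ∈ L²`. Positivity of `s`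
  -- is what forces `ε > 0` when `α = 1`.
  have hs : 0 < α - 1 + 2 * ε := by
    rcases hα1.eq_or_lt with h1 | h1
    · linarith [hε' h1.symm]
    · linarith
  have hI := hardy (s := α - 1 + 2 * ε) hs (by linarith) a5 a1 a3
  have hm : MemLp (fun z => z.2 ^ (α / 2 + ε - 1) * u z) 2 (volume.restrict Omega) := by
    refine (memLp_two_iff_integrable_sq (((measurable_rpow_const' _).comp
      measurable_snd).aestronglyMeasurable.mul a1.aestronglyMeasurable)).2 ?_
    refine integrable_congr_Omega hI fun z hz => ?_
    change _ = (z.2 ^ (α / 2 + ε - 1) * u z) ^ 2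
    rw [mul_pow, ← rpow_natCast (z.2 ^ _), ← rpow_mul hz.1.le]
    congr 2; push_cast; ring
  obtain ⟨P, Q, h1, h2, h3, h4⟩ := isWeakGrad_rpow_mul (κ := α / 2 + ε) (by norm_num) a4 a5 a2 a3
    (by linarith) (by linarith) hm
  exact ⟨h2, P, Q, h1, h3, h4⟩

/-- `r u² = 0` on `Γ^*`. -/
theorem IsH1w.vanishesOnGammaStar_sq (h : IsH1w α u p q) (hα : α ∈ Ico (1 : ℝ) 2) :
    VanishesOnGammaStar (fun z => z.2 * u z ^ 2) := by
  obtain ⟨a1, a2, a3, a4, a5⟩ := isH1w_iff.1 h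
  obtain ⟨hα1, hα2⟩ := hα
  -- For `κ = 1` the weight has constant derivative, and `u² ∈ L^1` takes the place of Hardy's
  -- inequality.
  have hI : Integrable (fun z => z.2 ^ ((1 : ℝ) - 1) * u z ^ 2) (volume.restrict Omega) := by
    simpa using a1.integrable_sq
  obtain ⟨P, Q, h1, h2, h3, h4⟩ := isWeakGrad_rpow_mul_sq (κ := 1) a4 a5 (memLp_zero_rpow a1)
    (memLp_zero_rpow a2) a3 (by linarith) (by linarith) hI
  simp only [rpow_one] at h1
  exact vanishesOnGammaStar_mul a1.integrable_sq h1 h3 h4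

/-- `r u = 0` on `Γ^*`. -/
theorem IsH1w.vanishesOnGammaStar (h : IsH1w α u p q) (hα : α ∈ Ico (1 : ℝ) 2) :
    VanishesOnGammaStar (fun z => z.2 * u z) := by
  obtain ⟨a1, a2, a3, a4, a5⟩ := isH1w_iff.1 h
  obtain ⟨hα1, hα2⟩ := hα
  have hI : MemLp (fun z => z.2 ^ ((1 : ℝ) - 1) * u z) 2 (volume.restrict Omega) := by
    simpa using a1
  obtain ⟨P, Q, h1, h2, h3, h4⟩ := isWeakGrad_rpow_mul (κ := 1) (by norm_num) a4 a5 a2 a3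
    (by linarith) (by linarith) hI
  simp only [rpow_one] at h1
  exact vanishesOnGammaStar_mul (integrable_of_memLp_two a1) h1 (integrable_of_memLp_two h3)
    (integrable_of_memLp_two h4)

/-- The weighted energy density `r (∇u · A∇u)` is in `W^{1,1}(Ω)` and vanishes on `Γ^*`. -/
theorem IsH1w.energy_density (h : IsH1w α u p q) (hα : α ∈ Ico (1 : ℝ) 2) {P R : Cyl → ℝ}
    (hg : MemLp g 2 (volume.restrict Omega))
    (hP : MemLp P 2 (volume.restrict Omega)) (hR : MemLp R 2 (volume.restrict Omega))
    (hpP : WD (1, 0) Omega p P) (hpR : WD (0, 1) Omega p (fun z => z.2 ^ (-(α / 2)) * R z))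
    (hvR : WD (1, 0) Omega (fun z => z.2 ^ α * q z) (fun z => z.2 ^ (α / 2) * R z))
    (hvg : WD (0, 1) Omega (fun z => z.2 ^ α * q z) (fun z => -(g z + P z))) :
    MemW1 1 (fun z => z.2 * (p z ^ 2 + z.2 ^ α * q z ^ 2)) ∧
      VanishesOnGammaStar (fun z => z.2 * (p z ^ 2 + z.2 ^ α * q z ^ 2)) := by
  obtain ⟨a1, a2, a3, a4, a5⟩ := isH1w_iff.1 h
  obtain ⟨hα1, hα2⟩ := hα
  have hcancel : ∀ (a b c : ℝ) (f : Cyl → ℝ), a + b = c →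
      ∀ z ∈ Omega, z.2 ^ c * f z = z.2 ^ a * (z.2 ^ b * f z) := fun a b c f hc z hz => by
    rw [← mul_assoc, ← rpow_add hz.1, hc]
  have mS : MemLp (fun z : Cyl => z.2 ^ (α / 2) * (z.2 ^ (-(α / 2)) * R z)) 2
      (volume.restrict Omega) :=
    memLp_congr_Omega (memLp_zero_rpow hR) (hcancel _ _ _ _ (by ring))
  have mv : MemLp (fun z : Cyl => z.2 ^ (-(α / 2)) * (z.2 ^ α * q z)) 2
      (volume.restrict Omega) := memLp_congr_Omega a3 (hcancel _ _ _ _ (by ring))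
  have mV : MemLp (fun z : Cyl => z.2 ^ (-(α / 2)) * (z.2 ^ (α / 2) * R z)) 2
      (volume.restrict Omega) :=
    memLp_congr_Omega (memLp_zero_rpow hR) (hcancel _ _ _ _ (by ring))
  have mW : MemLp (fun z : Cyl => z.2 ^ (0 : ℝ) * -(g z + P z)) 2 (volume.restrict Omega) :=
    memLp_zero_rpow (hg.add hP).neg
  have hIp : Integrable (fun z => z.2 ^ ((1 : ℝ) - 1) * p z ^ 2) (volume.restrict Omega) := by
    simpa using a2.integrable_sq
  have hIv : Integrable (fun z => z.2 ^ (1 - α - 1) * (z.2 ^ α * q z) ^ 2)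
      (volume.restrict Omega) := by
    refine integrable_congr_Omega h.integrable_weighted_sq fun z hz => ?_
    rw [mul_pow, sq (z.2 ^ α), ← mul_assoc, ← mul_assoc, ← rpow_add hz.1, ← rpow_add hz.1]
    congr 2; ring
  obtain ⟨P₁, Q₁, h1, j1, k1, l1⟩ := isWeakGrad_rpow_mul_sq (κ := 1) hpP hpR (memLp_zero_rpow a2)
    (memLp_zero_rpow hP) mS (by linarith) (by linarith) hIp
  -- The radial term is written through the flux `r^α q`, whose radial derivative the equation
  -- controls in `L²`. The exponent condition for that derivative is `-α/2 ≤ 1 - α`, that is, `α ≤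
  -- 2`.
  obtain ⟨P₂, Q₂, h2, j2, k2, l2⟩ := isWeakGrad_rpow_mul_sq (κ := 1 - α) hvR hvg mv mV mW
    (by linarith) (by linarith) hIv
  have hEq : ∀ z ∈ Omega, z.2 ^ (1 : ℝ) * p z ^ 2 + z.2 ^ (1 - α) * (z.2 ^ α * q z) ^ 2
      = z.2 * (p z ^ 2 + z.2 ^ α * q z ^ 2) := fun z hz => by
    have e1 : z.2 ^ (1 - α) * z.2 ^ α = z.2 := by rw [← rpow_add hz.1]; simp
    rw [rpow_one]
    linear_combination (z.2 ^ α * q z ^ 2) * e1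
  have hgrad := (h1.add h2).congr hEq
  exact ⟨hgrad.memW1_one (integrable_congr_Omega (j1.add j2) hEq) (k1.add k2)
    (l1.add l2), vanishesOnGammaStar_mul (a2.integrable_sq.add h.integrable_weighted_sq) hgrad
    (k1.add k2) (l1.add l2)⟩

end

end

end DegenerateCylinder

/-- Here `(p, q) = (∂_θ u, ∂_r u)` is the weak gradient of `u` in `Ω`, so that
`∇u · A∇u = p² + r^α q²`. -/
theorem lemma2p21 (α : ℝ) (hα : α ∈ Ico (1 : ℝ) 2) (g u p q : Cyl → ℝ)
    (hg : MemLp g 2 muOmega) (hu : IsWeakSolution α g u) (hgrad : IsWeakGrad u p q) :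
    VanishesOnGamma p ∧
    (MemW1 1 (fun z => z.2 ^ (α / 2) * u z ^ 2) ∧
      (∀ ε ∈ Ico (0 : ℝ) ((2 - α) / 4), (α = 1 → 0 < ε) →
        MemW1 2 (fun z => z.2 ^ (α / 2 + ε) * u z)) ∧
      VanishesOnGammaStar (fun z => z.2 * u z ^ 2) ∧
      VanishesOnGammaStar (fun z => z.2 * u z)) ∧
    (MemW1 1 (fun z => z.2 * (p z ^ 2 + z.2 ^ α * q z ^ 2)) ∧
      VanishesOnGammaStar (fun z => z.2 * (p z ^ 2 + z.2 ^ α * q z ^ 2))) := by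
  -- By uniqueness of weak derivatives the given `(p, q)` agrees almost everywhere with the gradient
  -- supplied by membership in `H^1_Γ`.
  have h := hu.memH1Gamma.isH1Gamma hgrad
  have hα0 : 0 ≤ α := zero_le_one.trans hα.1
  obtain ⟨P, R, hP, hR, hpP, hpR, hqR, hvR, hvg⟩ := hu.regularity hα0 hg h
  exact ⟨h.vanishesOnGamma_theta hα0 hP hR hpP hpR hqR,
    ⟨h.1.memW1_sq hα, fun ε hε hε' => h.1.memW1_rpow_mul hα hε.1 hε',
      h.1.vanishesOnGammaStar_sq hα, h.1.vanishesOnGammaStar hα⟩,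
    h.1.energy_density hα hg hP hR hpP hpR hvR hvg⟩
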